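/- **Setup.** Let $\mathrm E=\{(0),(ij),(k)\mid 1\le i<j\le 5,\ 1\le k\le 5\}$ be the set of the sixteen weights of the half-spin representation $S=\Lambda^0W\oplus\Lambda^2W\oplus\Lambda^4W$ ($W=\mathbb C^5$) of $\mathrm{Spin}(10)$, and let $\hat{\mathrm E}=\mathrm E\times\mathbb Z$, with $(\alpha,l)$ written $\alpha^l$ (and $\alpha=\alpha^0$). Write $\lambda,w_{ij},p_k$ for the coordinates on $S$ with indices $(0),(ij),(k)$. The pure spinor quadrics $\Gamma^{1},\dots,\Gamma^5,\Gamma^{1^*},\dots,\Gamma^{5^*}$ are the components of the $\mathrm{Spin}(10)$-equivariant map $\mathrm{Sym}^2S\to V=\mathbb C^{10}$: $$\begin{aligned} \Gamma^1&=\lambda p_1+w_{25}w_{34}-w_{24}w_{35}+w_{23}w_{45}, & \Gamma^{1^*}&=-p_2w_{12}+p_3w_{13}-p_4w_{14}+p_5w_{15},\\ \Gamma^2&=-\lambda p_2-w_{15}w_{34}+w_{14}w_{35}-w_{13}w_{45}, & \Gamma^{2^*}&=-p_1w_{12}+p_3w_{23}-p_4w_{24}+p_5w_{25},\\ \Gamma^3&=\lambda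 p_3+w_{15}w_{24}-w_{14}w_{25}+w_{12}w_{45}, & \Gamma^{3^*}&=-p_1w_{13}+p_2w_{23}-p_4w_{34}+p_5w_{35},\\ \Gamma^4&=-\lambda p_4-w_{15}w_{23}+w_{13}w_{25}-w_{12}w_{35}, & \Gamma^{4^*}&=-p_1w_{14}+p_2w_{24}-p_3w_{34}+p_5w_{45},\\ \Gamma^5&=\lambda p_5+w_{14}w_{23}-w_{13}w_{24}+w_{12}w_{34}, & \Gamma^{5^*}&=-p_1w_{15}+p_2w_{25}-p_3w_{35}+p_4w_{45}. \end{aligned}$$ Order $\hat{\mathrm E}$ by letting $\hat\alpha\le\hat\beta$ if there is a (possibly empty) directed path from $\hat\alpha$ to $\hat\beta$ in the graph whose arrows are, for every $l\in\mathbb Z$, the arrows $\alpha^l\to\beta^l$ for $(0)\to(12)\to(13)$; $(13)\to(23),(14)$; $(23)\to(24)$; $(14)\to(24),(15)$; $(24)\to(34),(25)$; $(15)\to(25)$; $(34)\to(5),(35)$; $(25)\to(35)$; $(5)\to(4)$; $(35)\to(4),(45)$; $(4)\to(3)$; $(45)\to(3)$; $(3)\to(2)\to(1)$, together with $(45)^l\to(0)^{l+1}$,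 $(3)^l\to(12)^{l+1}$, $(2)^l\to(13)^{l+1}$, $(1)^l\to(23)^{l+1}$. Intervals $[\hat\delta,\hat\delta']$ are finite. For $\hat\delta,\hat\delta'\in\hat{\mathrm E}$ let $A_{\hat\delta}^{\hat\delta'}$ be the quotient of $\mathbb C[\lambda^{\hat\alpha}\mid\hat\alpha\in[\hat\delta,\hat\delta']]$ by the ideal generated by all coefficients of powers of $z$ in the Laurent polynomials obtained by substituting $\lambda^\alpha(z)=\sum_{l:\,\alpha^l\in[\hat\delta,\hat\delta']}\lambda^{\alpha^l}z^l$ for the coordinate with index $\alpha$ (for all $\alpha\in\mathrm E$) in the ten quadrics. It is graded by $\deg\lambda^{\hat\alpha}=1$; its Poincaré series is $A_{\hat\delta}^{\hat\delta'}(t)=\sum_{n\ge0}\dim_{\mathbb C}(A_{\hat\delta}^{\hat\delta'})_n\,t^n$. Let $\hat\delta_0,\hat\delta_1,\hat\delta_2,\dots$ be the sequence $(15)^0,(5)^0,(0)^1,(1)^0,(15)^1,(5)^1,(0)^2,(1)^1,\dots$, in which $\hat\delta_{r+4}$ is obtained from $\hat\delta_r$ by raising the exponent by $1$. Let $D_0=1$,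 $D_1=1+t$ and $D_r=(1+t)D_{r-1}+tD_{r-2}$ for $r\ge2$ (the Delannoy polynomials). **Corollary.** For every integer $r\ge0$, in $\mathbb Z[[t]]$, $$A_{(0)^0}^{\hat\delta_r}(t)=\frac{D_r(t)}{(1-t)^{5+2r}} .$$ -/

import Mathlib

namespace QuantumOGr

/-- The sixteen weights `(0)`, `(ij)` (`1 ≤ i < j ≤ 5`), `(k)` (`1 ≤ k ≤ 5`) of the half-spin
representation `S = Λ⁰W ⊕ Λ²W ⊕ Λ⁴W`, `W = ℂ⁵`, of `Spin(10)`. They label the basis `1`, `v_i ∧ v_j`,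
`v_1 ∧ … v̂_k … ∧ v_5`. The coordinate of `(0)` is written `λ`, that of `(ij)` is `w_ij`, and that
of `(k)` is `p_k`. -/
inductive Weight : Type
  | o
  | w12 | w13 | w14 | w15 | w23 | w24 | w25 | w34 | w35 | w45
  | p1 | p2 | p3 | p4 | p5
  deriving DecidableEq

instance : Fintype Weight where
  elems := {.o, .w12, .w13, .w14, .w15, .w23, .w24, .w25, .w34, .w35, .w45, .p1, .p2, .p3, .p4, .p5}
  complete x := by cases x <;> decide

/-- Indices of the basis `v_1, …, v_5, v_{1*}, …, v_{5*}` of the ten-dimensional vector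
representation; `sᵢ` stands for `i*`. -/
inductive VectorIndex : Type
  | v1 | v2 | v3 | v4 | v5
  | s1 | s2 | s3 | s4 | s5
  deriving DecidableEq

/-- The pure spinor quadrics: the ten components `∑_{α,β} Γ^s_{αβ} x_α x_β` of the
`Spin(10)`-equivariant map `Sym² S → V`, in coordinates. The first five are
`± (λ p_i + Pf_i(w))` and the last five are the entries of `w p` (with alternating signs of `p`). -/
def pureSpinorQuadric {R : Type*} [CommRing R] (x : Weight → R) : VectorIndex → R
  | .v1 => x .o * x .p1 + x .w25 * x .w34 - x .w24 * x .w35 + x .w23 * x .w45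
  | .v2 => -(x .o * x .p2) - x .w15 * x .w34 + x .w14 * x .w35 - x .w13 * x .w45
  | .v3 => x .o * x .p3 + x .w15 * x .w24 - x .w14 * x .w25 + x .w12 * x .w45
  | .v4 => -(x .o * x .p4) - x .w15 * x .w23 + x .w13 * x .w25 - x .w12 * x .w35
  | .v5 => x .o * x .p5 + x .w14 * x .w23 - x .w13 * x .w24 + x .w12 * x .w34
  | .s1 => -(x .p2 * x .w12) + x .p3 * x .w13 - x .p4 * x .w14 + x .p5 * x .w15
  | .s2 => -(x .p1 * x .w12) + x .p3 * x .w23 - x .p4 * x .w24 + x .p5 * x .w25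
  | .s3 => -(x .p1 * x .w13) + x .p2 * x .w23 - x .p4 * x .w34 + x .p5 * x .w35
  | .s4 => -(x .p1 * x .w14) + x .p2 * x .w24 - x .p3 * x .w34 + x .p5 * x .w45
  | .s5 => -(x .p1 * x .w15) + x .p2 * x .w25 - x .p3 * x .w35 + x .p4 * x .w45

/-- Arrows of the Hasse diagram of the weights of `S`. -/
inductive Arrow : Weight → Weight → Prop
  | o_12 : Arrow .o .w12
  | a12_13 : Arrow .w12 .w13
  | a13_23 : Arrow .w13 .w23
  | a13_14 : Arrow .w13 .w14
  | a23_24 : Arrow .w23 .w24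
  | a14_24 : Arrow .w14 .w24
  | a14_15 : Arrow .w14 .w15
  | a24_34 : Arrow .w24 .w34
  | a24_25 : Arrow .w24 .w25
  | a15_25 : Arrow .w15 .w25
  | a34_5 : Arrow .w34 .p5
  | a34_35 : Arrow .w34 .w35
  | a25_35 : Arrow .w25 .w35
  | a5_4 : Arrow .p5 .p4
  | a35_4 : Arrow .w35 .p4
  | a35_45 : Arrow .w35 .w45
  | a4_3 : Arrow .p4 .p3
  | a45_3 : Arrow .w45 .p3
  | a3_2 : Arrow .p3 .p2
  | a2_1 : Arrow .p2 .p1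

/-- The additional arrows of the affine Hasse diagram, going from level `l` to level `l + 1`. -/
inductive LoopArrow : Weight → Weight → Prop
  | a45_o : LoopArrow .w45 .o
  | a3_12 : LoopArrow .p3 .w12
  | a2_13 : LoopArrow .p2 .w13
  | a1_23 : LoopArrow .p1 .w23

/-- The set `Ê = E × ℤ`; the pair `(α, l)` is written `α^l`. -/
@[ext] structure AffineWeight : Type where
  weight : Weight
  level : ℤ
  deriving DecidableEq

/-- Arrows of the affine Hasse diagram on `Ê`. -/
inductive AffineArrow : AffineWeight → AffineWeight → Prop
  | same {α β : Weight} (h : Arrow α β) (l : ℤ) : AffineArrow ⟨α, l⟩ ⟨β, l⟩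
  | next {α β : Weight} (h : LoopArrow α β) (l : ℤ) : AffineArrow ⟨α, l⟩ ⟨β, l + 1⟩

/-- The height function on `E`: it increases by one along each arrow. -/
def Weight.ht : Weight → ℤ
  | .o => 0 | .w12 => 1 | .w13 => 2 | .w14 => 3 | .w23 => 3 | .w15 => 4 | .w24 => 4
  | .w25 => 5 | .w34 => 5 | .w35 => 6 | .p5 => 6 | .w45 => 7 | .p4 => 7
  | .p3 => 8 | .p2 => 9 | .p1 => 10

/-- The height function on `Ê`. -/
def AffineWeight.ht (a : AffineWeight) : ℤ := 8 * a.level + a.weight.ht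

theorem AffineArrow.ht_eq {a b : AffineWeight} (h : AffineArrow a b) : b.ht = a.ht + 1 := by
  rcases h with ⟨h, l⟩ | ⟨h, l⟩ <;> cases h <;> simp only [AffineWeight.ht, Weight.ht] <;> ring

theorem ht_le_of_path {a b : AffineWeight} (h : Relation.ReflTransGen AffineArrow a b) :
    a = b ∨ a.ht < b.ht := by
  induction h with
  | refl => exact Or.inl rfl
  | tail _ hbc ih =>
    have := hbc.ht_eq
    rcases ih with rfl | ih
    · right; omega
    · right; omega

/-- The order on `Ê`: `a ≤ b` when there is a directed path from `a` to `b`. -/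
instance : PartialOrder AffineWeight where
  le a b := Relation.ReflTransGen AffineArrow a b
  le_refl _ := Relation.ReflTransGen.refl
  le_trans _ _ _ := Relation.ReflTransGen.trans
  le_antisymm a b hab hba := by
    rcases ht_le_of_path hab with h | h
    · exact h
    · rcases ht_le_of_path hba with h' | h'
      · exact h'.symm
      · omega

theorem finite_Icc (a b : AffineWeight) : (Set.Icc a b).Finite := by
  refine Set.Finite.subset (((Set.finite_univ (α := Weight)).prod
    (Set.finite_Icc ((a.ht - 10) / 8) (b.ht / 8))).image
      (fun x : Weight × ℤ => (⟨x.1, x.2⟩ : AffineWeight))) ?_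
  rintro ⟨α, l⟩ ⟨h1, h2⟩
  refine ⟨(α, l), ⟨Set.mem_univ _, ?_⟩, rfl⟩
  have h1' : a.ht ≤ 8 * l + α.ht := by
    rcases ht_le_of_path h1 with h | h
    · exact le_of_eq (congrArg AffineWeight.ht h)
    · exact le_of_lt h
  have h2' : 8 * l + α.ht ≤ b.ht := by
    rcases ht_le_of_path h2 with h | h
    · exact le_of_eq (congrArg AffineWeight.ht h)
    · exact le_of_lt h
  have h3 : 0 ≤ α.ht ∧ α.ht ≤ 10 := by cases α <;> simp [Weight.ht]
  simp only [Set.mem_Icc]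
  omega

noncomputable instance : LocallyFiniteOrder AffineWeight :=
  LocallyFiniteOrder.ofFiniteIcc finite_Icc

/-- The polynomial ring `ℂ[λ^α̂ : α̂ ∈ [a, b]]`. -/
abbrev PolyRing (a b : AffineWeight) : Type := MvPolynomial (Set.Icc a b) ℂ

/-- The generating function `λ^α(z) = ∑_{l : α^l ∈ [a, b]} λ^{α^l} z^l`. -/
noncomputable def genFun (a b : AffineWeight) (α : Weight) : LaurentPolynomial (PolyRing a b) :=
  ∑ i : Set.Icc a b with i.1.weight = α,
    LaurentPolynomial.C (MvPolynomial.X i) * LaurentPolynomial.T i.1.level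

/-- The relation `Γ^{s^l}`: the coefficient of `z^l` in the quadric `Γ^s` evaluated at the
generating functions `λ^α(z)`. -/
noncomputable def relation (a b : AffineWeight) (s : VectorIndex) (l : ℤ) : PolyRing a b :=
  (pureSpinorQuadric (genFun a b) s).coeff l

/-- The ideal generated by all the relations `Γ^{s^l}`. -/
noncomputable def relationIdeal (a b : AffineWeight) : Ideal (PolyRing a b) :=
  Ideal.span (Set.range fun q : VectorIndex × ℤ => relation a b q.1 q.2)

/-- The algebra `A_a^b` of the semi-infinite Richardson variety of the interval `[a, b]`. -/
abbrev RichardsonAlgebra (a b : AffineWeight) : Type := PolyRing a b ⧸ relationIdeal a b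

/-- The `n`-th graded component of `A_a^b`: the image of the forms of degree `n`. -/
noncomputable def gradedPiece (a b : AffineWeight) (n : ℕ) :
    Submodule ℂ (RichardsonAlgebra a b) :=
  (MvPolynomial.homogeneousSubmodule (Set.Icc a b) ℂ n).map
    (Ideal.Quotient.mkₐ ℂ (relationIdeal a b)).toLinearMap

/-- The Poincaré series `A_a^b(t) = A_a^b(1, 1, t) = ∑ₙ dim (A_a^b)ₙ tⁿ`. -/
noncomputable def poincareSeries (a b : AffineWeight) : PowerSeries ℤ :=
  PowerSeries.mk fun n => (Module.finrank ℂ (gradedPiece a b n) : ℤ)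

/-- The sequence `δ̂_0, δ̂_1, δ̂_2, … = (15)^0, (5)^0, (0)^1, (1)^0, (15)^1, (5)^1, (0)^2, (1)^1, …`
with `δ̂_{r+4}` obtained from `δ̂_r` by raising the level by one. -/
def deltaHat : ℕ → AffineWeight
  | 0 => ⟨.w15, 0⟩
  | 1 => ⟨.p5, 0⟩
  | 2 => ⟨.o, 1⟩
  | 3 => ⟨.p1, 0⟩
  | r + 4 => ⟨(deltaHat r).weight, (deltaHat r).level + 1⟩

/-- The Delannoy polynomials. -/
noncomputable def delannoyPoly : ℕ → Polynomial ℤ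
  | 0 => 1
  | 1 => 1 + Polynomial.X
  | r + 2 => (1 + Polynomial.X) * delannoyPoly (r + 1) + Polynomial.X * delannoyPoly r

end QuantumOGr

/-! The relations form a Gröbner basis whose initial ideal is generated by the products of
incomparable variables. The Poincaré series therefore counts multichains of the interval, and a
short recursion along the poset evaluates that count.

The coordinates `fst`, `snd` turn the affine poset into a strip in `ℤ × ℤ` with the componentwise
order (`AffineWeight.le_iff`) and height `fst + snd`. Each relation is homogeneous for the height
and contains a single product `x y` of incomparable variables. Its other terms `u v` are nested
around it, `u ≤ x, y ≤ v` (`nested_terms`), and every incomparable pair arises in this way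
(`exists_lead_of_incomparable`). Since `u.ht + v.ht = x.ht + y.ht`, nesting makes the sum of squared
heights larger, so giving a variable the weight `-ht ^ 2`, up to a constant, makes `x y` the leading
term.

Buchberger's criterion is then checked by hand. S-pairs with coprime leading terms reduce formally.
S-pairs sharing a variable are completed by one of the sixteen linear syzygies of the pure spinor
quadrics, all of whose remaining terms have smaller weight (`exists_syzygy`); translation of levels
reduces this to a finite table. Restriction to an interval is harmless, because a relation whose
leading term leaves the interval vanishes altogether (`relation_eq_zero`). Hence monomials supported
on chains form a basis (`relFamily_isLiftable`, `isStd_leadExp_iff`).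

For the count, removing the top element of a lower interval multiplies the multichain series by `1 -
t`; an element with two lower covers contributes by inclusion-exclusion. Along the strip this is a
periodic linear system in four series, and eliminating three of them leaves the Delannoy recursion
(`lowerSeries_deltaHat_add_two`). -/

namespace StandardMonomials

/-! ### Standard monomial bases from liftable S-pairs. -/

open MvPolynomial Finsupp

variable {K σ ι : Type*} [Field K]

/-- The span of the monomials of the degree of `d` and of smaller weight. -/
noncomputable def smallSpan (K : Type*) [Field K] (w : σ → ℕ) (d : σ →₀ ℕ) :
    Submodule K (MvPolynomial σ K) :=
  Submodule.span K {p | ∃ m : σ →₀ ℕ, weight w m < weight w d ∧ m.degree = d.degree ∧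
    p = monomial m 1}

/-- The span of the monomial multiples of the `f ρ` whose leading monomial has weight less
than `N`. -/
noncomputable def lowerSpan (w : σ → ℕ) (e : ι → σ →₀ ℕ) (f : ι → MvPolynomial σ K) (N : ℕ) :
    Submodule K (MvPolynomial σ K) :=
  Submodule.span K {p | ∃ m ρ, weight w (m + e ρ) < N ∧ p = monomial m 1 * f ρ}

/-- The family `f` has leading exponents `e` with respect to the weight `w`, and all S-pairs
reduce to elements of smaller weight. -/
structure IsLiftable (w : σ → ℕ) (e : ι → σ →₀ ℕ) (f : ι → MvPolynomial σ K) : Prop where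
  lead : ∀ ρ, ∃ c : K, c ≠ 0 ∧ f ρ - c • monomial (e ρ) 1 ∈ smallSpan K w (e ρ)
  syz : ∀ m m' ρ ρ', m + e ρ = m' + e ρ' →
    monomial m 1 * f ρ ∈
      Submodule.span K {monomial m' 1 * f ρ'} ⊔ lowerSpan w e f (weight w (m + e ρ))

variable {w : σ → ℕ} {e : ι → σ →₀ ℕ} {f : ι → MvPolynomial σ K}

theorem lowerSpan_mono {N N' : ℕ} (h : N ≤ N') : lowerSpan w e f N ≤ lowerSpan w e f N' :=
  Submodule.span_mono fun _ ⟨m, ρ, h1, h2⟩ => ⟨m, ρ, h1.trans_le h, h2⟩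

theorem mem_lowerSpan {m : σ →₀ ℕ} {ρ : ι} {N : ℕ} (h : weight w (m + e ρ) < N) :
    monomial m 1 * f ρ ∈ lowerSpan w e f N :=
  Submodule.subset_span ⟨m, ρ, h, rfl⟩

theorem monomial_mul_mem_lowerSpan (m : σ →₀ ℕ) {N : ℕ} {p : MvPolynomial σ K}
    (hp : p ∈ lowerSpan w e f N) : monomial m 1 * p ∈ lowerSpan w e f (weight w m + N) := by
  induction hp using Submodule.span_induction with
  | mem x hx =>
    obtain ⟨m', ρ, h, rfl⟩ := hx
    rw [← mul_assoc, monomial_mul, one_mul]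
    refine mem_lowerSpan ?_
    rw [add_assoc, map_add]
    omega
  | zero => simp
  | add x y _ _ hx hy => rw [mul_add]; exact add_mem hx hy
  | smul c x _ hx => rw [mul_smul_comm]; exact Submodule.smul_mem _ _ hx

theorem smallSpan_mul_mem_lowerSpan {d m : σ →₀ ℕ} {ρ : ι} {N : ℕ} {p : MvPolynomial σ K}
    (hp : p ∈ smallSpan K w d) (hN : weight w (d + m + e ρ) ≤ N) :
    p * (monomial m 1 * f ρ) ∈ lowerSpan w e f N := by
  induction hp using Submodule.span_induction with
  | mem x hx =>
    obtain ⟨m', h, -, rfl⟩ := hx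
    rw [← mul_assoc, monomial_mul, one_mul]
    refine mem_lowerSpan (lt_of_lt_of_le ?_ hN)
    simp only [map_add]
    omega
  | zero => simp
  | add x y _ _ hx hy => rw [add_mul]; exact add_mem hx hy
  | smul c x _ hx => rw [smul_mul_assoc]; exact Submodule.smul_mem _ _ hx

/-- S-pairs with coprime leading monomials reduce. -/
theorem coprime_syzygy
    (lead : ∀ ρ, ∃ c : K, c ≠ 0 ∧ f ρ - c • monomial (e ρ) 1 ∈ smallSpan K w (e ρ))
    (m : σ →₀ ℕ) (ρ ρ' : ι) :
    monomial (m + e ρ') 1 * f ρ ∈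
      Submodule.span K {monomial (m + e ρ) 1 * f ρ'} ⊔
        lowerSpan w e f (weight w (m + e ρ' + e ρ)) := by
  obtain ⟨c, hc, h⟩ := lead ρ
  obtain ⟨c', hc', h'⟩ := lead ρ'
  -- Buchberger's product criterion: with `g`, `g'` the two leading terms, `(f - g) f' - (f' - g') f
  -- = g' f - g f'`.
  have key : monomial (m + e ρ') 1 * f ρ =
      c'⁻¹ • (c • (monomial (m + e ρ) 1 * f ρ')) +
      c'⁻¹ • ((f ρ - c • monomial (e ρ) 1) * (monomial m 1 * f ρ') -
        (f ρ' - c' • monomial (e ρ') 1) * (monomial m 1 * f ρ)) := by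
    have e1 : (monomial (m + e ρ') 1 : MvPolynomial σ K) = monomial m 1 * monomial (e ρ') 1 := by
      rw [monomial_mul, one_mul]
    have e2 : (monomial (m + e ρ) 1 : MvPolynomial σ K) = monomial m 1 * monomial (e ρ) 1 := by
      rw [monomial_mul, one_mul]
    rw [e1, e2, eq_comm, ← smul_add, inv_smul_eq_iff₀ hc']
    simp only [smul_eq_C_mul]
    ring
  rw [key]
  refine Submodule.add_mem_sup ?_ ?_
  · exact Submodule.smul_mem _ _ (Submodule.smul_mem _ _ (Submodule.mem_span_singleton_self _))
  · refine Submodule.smul_mem _ _ (sub_mem ?_ ?_)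
    · exact smallSpan_mul_mem_lowerSpan h (le_of_eq (by congr 1; abel))
    · exact smallSpan_mul_mem_lowerSpan h' (le_of_eq (by congr 1; abel))

/-- Lets the reduction of a minimal S-pair serve for all its monomial multiples. -/
theorem syzygy_mul {m m' : σ →₀ ℕ} {ρ ρ' : ι} {N : ℕ} (n : σ →₀ ℕ)
    (h : monomial m 1 * f ρ ∈ Submodule.span K {monomial m' 1 * f ρ'} ⊔ lowerSpan w e f N) :
    monomial (n + m) 1 * f ρ ∈
      Submodule.span K {monomial (n + m') 1 * f ρ'} ⊔ lowerSpan w e f (weight w n + N) := by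
  obtain ⟨p, hp, q, hq, hpq⟩ := Submodule.mem_sup.1 h
  obtain ⟨c, rfl⟩ := Submodule.mem_span_singleton.1 hp
  have : monomial (n + m) 1 * f ρ = c • (monomial (n + m') 1 * f ρ') + monomial n 1 * q := by
    have e1 (k : σ →₀ ℕ) : (monomial (n + k) 1 : MvPolynomial σ K) =
        monomial n 1 * monomial k 1 := by
      rw [monomial_mul, one_mul]
    rw [e1, e1, mul_assoc, ← hpq, smul_eq_C_mul, smul_eq_C_mul]
    ring
  rw [this]
  exact Submodule.add_mem_sup (Submodule.smul_mem _ _ (Submodule.mem_span_singleton_self _))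
    (monomial_mul_mem_lowerSpan n hq)

/-- For quadratic squarefree leading monomials it suffices to treat S-pairs whose leading
monomials share one variable. -/
theorem IsLiftable.of_quadratic
    (lead : ∀ ρ, ∃ c : K, c ≠ 0 ∧ f ρ - c • monomial (e ρ) 1 ∈ smallSpan K w (e ρ))
    (hinj : Function.Injective e)
    (hquad : ∀ ρ, ∃ x y, x ≠ y ∧ e ρ = single x 1 + single y 1)
    (hsyz : ∀ ρ ρ' x y z, x ≠ y → x ≠ z → y ≠ z → e ρ = single x 1 + single y 1 →
      e ρ' = single x 1 + single z 1 →
      monomial (single z 1) 1 * f ρ ∈ Submodule.span K {monomial (single y 1) 1 * f ρ'} ⊔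
        lowerSpan w e f (weight w (single x 1 + single y 1 + single z 1))) :
    IsLiftable w e f := by
  classical
  refine ⟨lead, fun m m' ρ ρ' h => ?_⟩
  by_cases hρ : ρ = ρ'
  · subst hρ
    obtain rfl : m = m' := add_right_cancel h
    exact Submodule.mem_sup_left (Submodule.mem_span_singleton_self _)
  have share : ∀ x y z, x ≠ y → x ≠ z → e ρ = single x 1 + single y 1 →
      e ρ' = single x 1 + single z 1 → monomial m 1 * f ρ ∈
      Submodule.span K {monomial m' 1 * f ρ'} ⊔ lowerSpan w e f (weight w (m + e ρ)) := by
    intro x y z hxy hxz h1 h2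
    have hyz : y ≠ z := by
      rintro rfl
      exact hρ (hinj (h1.trans h2.symm))
    have h3 : m + single y 1 = m' + single z 1 := by
      rw [h1, h2] at h
      have : single x 1 + (m + single y 1) = single x 1 + (m' + single z 1) := by
        rw [add_left_comm, h, add_left_comm]
      exact add_left_cancel this
    obtain ⟨n, rfl⟩ : ∃ n, m = n + single z 1 := by
      refine ⟨m - single z 1, (tsub_add_cancel_of_le ?_).symm⟩
      rw [single_le_iff]
      have := DFunLike.congr_fun h3 z
      simp only [Finsupp.add_apply, single_apply, hyz, if_true, if_false] at this
      omega
    obtain rfl : m' = n + single y 1 := by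
      refine add_right_cancel (b := single z 1) ?_
      rw [← h3]; abel
    have := syzygy_mul n (hsyz ρ ρ' x y z hxy hxz hyz h1 h2)
    rw [← map_add] at this
    convert this using 4
    rw [h1]; abel
  obtain ⟨x, y, hxy, h1⟩ := hquad ρ
  obtain ⟨x', y', hxy', h2⟩ := hquad ρ'
  by_cases c1 : x = x'
  · subst c1; exact share x y y' hxy hxy' h1 h2
  by_cases c2 : x = y'
  · subst c2; exact share x y x' hxy hxy'.symm h1 (h2.trans (add_comm _ _))
  by_cases c3 : y = x'
  · subst c3; exact share y x y' hxy.symm hxy' (h1.trans (add_comm _ _)) h2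
  by_cases c4 : y = y'
  · subst c4
    exact share y x x' hxy.symm hxy'.symm (h1.trans (add_comm _ _)) (h2.trans (add_comm _ _))
  obtain ⟨n, rfl⟩ : ∃ n, m = n + e ρ' := by
    refine ⟨m - e ρ', (tsub_add_cancel_of_le ?_).symm⟩
    intro t
    have := DFunLike.congr_fun h t
    rw [h2]
    simp only [h1, h2, Finsupp.add_apply, single_apply] at this ⊢
    by_cases t1 : x' = t
    · subst t1
      simp [c1, c3, hxy'.symm] at this ⊢
      omega
    · by_cases t2 : y' = t
      · subst t2
        simp [c2, c4, t1] at this ⊢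
        omega
      · simp [t1, t2]
  obtain rfl : m' = n + e ρ := by
    refine add_right_cancel (b := e ρ') ?_
    rw [← h]; abel
  exact coprime_syzygy lead n ρ ρ'

/-- Exponents of standard monomials: not divisible by any leading monomial. -/
def IsStd (e : ι → σ →₀ ℕ) (m : σ →₀ ℕ) : Prop := ∀ ρ, ¬ e ρ ≤ m

/-- The bound `N` depends on `p` and need not be related to the weights occurring in `p`; it only
gives `IsLiftable.lowerSpan_le` a starting point for its induction. -/
theorem mem_iSup_lowerSpan_of_mem_ideal {p : MvPolynomial σ K}
    (hp : p ∈ Ideal.span (Set.range f)) : ∃ N, p ∈ lowerSpan w e f N := by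
  induction hp using Submodule.span_induction with
  | mem x hx =>
    obtain ⟨ρ, rfl⟩ := hx
    refine ⟨weight w (0 + e ρ) + 1, ?_⟩
    have := mem_lowerSpan (K := K) (f := f) (Nat.lt_succ_self (weight w (0 + e ρ)))
    rwa [show (monomial 0 1 : MvPolynomial σ K) = 1 from rfl, one_mul] at this
  | zero => exact ⟨0, zero_mem _⟩
  | add x y _ _ hx hy =>
    obtain ⟨N, hN⟩ := hx
    obtain ⟨N', hN'⟩ := hy
    exact ⟨max N N', add_mem (lowerSpan_mono (le_max_left _ _) hN)
      (lowerSpan_mono (le_max_right _ _) hN')⟩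
  | smul a x _ hx =>
    obtain ⟨N, hN⟩ := hx
    induction a using MvPolynomial.induction_on' with
    | monomial u c =>
      refine ⟨weight w u + N, ?_⟩
      have : (monomial u c : MvPolynomial σ K) = c • monomial u 1 := by
        rw [smul_monomial, smul_eq_mul, mul_one]
      rw [this, smul_eq_mul, smul_mul_assoc]
      exact Submodule.smul_mem _ _ (monomial_mul_mem_lowerSpan u hN)
    | add a b ha hb =>
      obtain ⟨N1, h1⟩ := ha
      obtain ⟨N2, h2⟩ := hb
      rw [add_smul]
      exact ⟨max N1 N2, add_mem (lowerSpan_mono (le_max_left _ _) h1)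
        (lowerSpan_mono (le_max_right _ _) h2)⟩

/-- Every element of the ideal is a combination of chosen multiples, one for each non-standard
monomial. -/
theorem IsLiftable.lowerSpan_le (h : IsLiftable w e f) (cm : {m // ¬ IsStd e m} → (σ →₀ ℕ))
    (cρ : {m // ¬ IsStd e m} → ι) (hc : ∀ m, cm m + e (cρ m) = m.1) (N : ℕ) :
    lowerSpan w e f N ≤ Submodule.span K (Set.range fun m => monomial (cm m) 1 * f (cρ m)) := by
  induction N using Nat.strong_induction_on with
  | _ N ih =>
    refine Submodule.span_le.2 ?_
    rintro _ ⟨m, ρ, hN, rfl⟩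
    have hns : ¬ IsStd e (m + e ρ) := fun hs => hs ρ le_add_self
    -- The given multiple and the chosen one have the same leading monomial, so they agree up to a
    -- scalar and an error of strictly smaller weight, which the induction handles.
    have := h.syz m _ ρ _ (hc ⟨_, hns⟩).symm
    refine (sup_le ?_ (ih _ hN)) this
    rw [Submodule.span_singleton_le_iff_mem]
    exact Submodule.subset_span ⟨⟨_, hns⟩, rfl⟩

theorem coeff_of_mem_smallSpan {d m : σ →₀ ℕ} {p : MvPolynomial σ K}
    (hp : p ∈ smallSpan K w d) (hm : weight w d ≤ weight w m) : coeff m p = 0 := by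
  classical
  induction hp using Submodule.span_induction with
  | mem x hx =>
    obtain ⟨m', h, -, rfl⟩ := hx
    rw [coeff_monomial, if_neg]
    rintro rfl
    omega
  | zero => simp
  | add x y _ _ hx hy => rw [coeff_add, hx, hy, add_zero]
  | smul c x _ hx => rw [coeff_smul, hx, smul_zero]

theorem monomial_mul_smallSpan {d : σ →₀ ℕ} (m : σ →₀ ℕ) {p : MvPolynomial σ K}
    (hp : p ∈ smallSpan K w d) : monomial m 1 * p ∈ smallSpan K w (m + d) := by
  induction hp using Submodule.span_induction with
  | mem x hx =>
    obtain ⟨m', h, h', rfl⟩ := hx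
    refine Submodule.subset_span ⟨m + m', ?_, ?_, by rw [monomial_mul, one_mul]⟩
    · simp only [map_add]; omega
    · simp only [map_add, h']
  | zero => simp
  | add x y _ _ hx hy => rw [mul_add]; exact add_mem hx hy
  | smul c x _ hx => rw [mul_smul_comm]; exact Submodule.smul_mem _ _ hx

theorem IsLiftable.lead_mul (h : IsLiftable w e f) (m : σ →₀ ℕ) (ρ : ι) :
    ∃ c : K, c ≠ 0 ∧ monomial m 1 * f ρ - c • monomial (m + e ρ) 1 ∈ smallSpan K w (m + e ρ) := by
  obtain ⟨c, hc, h1⟩ := h.lead ρ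
  refine ⟨c, hc, ?_⟩
  have := monomial_mul_smallSpan m h1
  rwa [mul_sub, mul_smul_comm, monomial_mul, one_mul] at this

/-- A nonzero combination of elements with distinct non-standard leading monomials involves a
non-standard monomial. -/
theorem eq_zero_of_mem_span_of_coeff_eq_zero {b : {m // ¬ IsStd e m} → MvPolynomial σ K}
    (hb : ∀ m, ∃ c : K, c ≠ 0 ∧ b m - c • monomial m.1 1 ∈ smallSpan K w m.1)
    {q : MvPolynomial σ K} (hq : q ∈ Submodule.span K (Set.range b))
    (h0 : ∀ m, ¬ IsStd e m → coeff m q = 0) : q = 0 := by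
  classical
  obtain ⟨d, rfl⟩ := (Finsupp.mem_span_range_iff_exists_finsupp).1 hq
  by_cases hd : d.support.Nonempty
  · exfalso
    -- At an exponent of maximal weight no other summand contributes: the leading exponents are
    -- distinct and all tails have strictly smaller weight. Ties in weight are therefore harmless,
    -- and no total monomial order is needed.
    obtain ⟨M, hM, hmax⟩ := d.support.exists_max_image (fun m => weight w m.1) hd
    have h1 := h0 M.1 M.2
    obtain ⟨c, hc, hcM⟩ := hb M
    rw [Finsupp.sum, coeff_sum, Finset.sum_eq_single M] at h1
    · have h2 := coeff_of_mem_smallSpan hcM le_rfl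
      rw [coeff_sub, coeff_smul, coeff_monomial, if_pos rfl, smul_eq_mul, mul_one, sub_eq_zero]
        at h2
      rw [coeff_smul, h2, smul_eq_mul] at h1
      exact (mul_ne_zero (Finsupp.mem_support_iff.1 hM) hc) h1
    · intro M' hM' hne
      obtain ⟨c', -, hcM'⟩ := hb M'
      have h2 := coeff_of_mem_smallSpan hcM' (hmax M' hM')
      rw [coeff_sub, coeff_smul, coeff_monomial, if_neg (fun h => hne (Subtype.ext h)),
        smul_zero, sub_zero] at h2
      rw [coeff_smul, h2, smul_zero]
    · intro h; exact absurd hM h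
  · rw [Finset.not_nonempty_iff_eq_empty, Finsupp.support_eq_empty] at hd
    simp [hd]

/-- Standard monomials are linearly independent modulo the ideal. -/
theorem IsLiftable.linearIndependent (h : IsLiftable w e f) :
    LinearIndependent K (fun m : {m : σ →₀ ℕ // IsStd e m} =>
      Ideal.Quotient.mkₐ K (Ideal.span (Set.range f)) (monomial m.1 1)) := by
  classical
  have hex : ∀ m : {m // ¬ IsStd e m}, ∃ q : (σ →₀ ℕ) × ι, q.1 + e q.2 = m.1 := by
    rintro ⟨m, hm⟩
    simp only [IsStd, not_forall, not_not] at hm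
    obtain ⟨ρ, hρ⟩ := hm
    exact ⟨(m - e ρ, ρ), tsub_add_cancel_of_le hρ⟩
  choose c hc using hex
  rw [linearIndependent_iff]
  intro l hl
  set q : MvPolynomial σ K := l.sum fun m a => monomial m.1 a with hqdef
  have hq : q ∈ Ideal.span (Set.range f) := by
    rw [← Ideal.Quotient.eq_zero_iff_mem, ← Ideal.Quotient.mkₐ_eq_mk K, hqdef, Finsupp.sum,
      map_sum, ← hl, Finsupp.linearCombination_apply, Finsupp.sum]
    refine Finset.sum_congr rfl fun m _ => ?_
    rw [← map_smul, smul_monomial, smul_eq_mul, mul_one]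
  have hcoeff (m : σ →₀ ℕ) : coeff m q = ∑ m' ∈ l.support, if m'.1 = m then l m' else 0 := by
    rw [hqdef, Finsupp.sum, coeff_sum]
    simp only [coeff_monomial]
  obtain ⟨N, hN⟩ := mem_iSup_lowerSpan_of_mem_ideal (w := w) (e := e) hq
  have hq0 : q = 0 := by
    refine eq_zero_of_mem_span_of_coeff_eq_zero (e := e) (w := w) ?_
      (h.lowerSpan_le (fun m => (c m).1) (fun m => (c m).2) hc N hN) ?_
    · intro m
      have := h.lead_mul (c m).1 (c m).2
      rwa [hc] at this
    · intro m hm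
      rw [hcoeff]
      refine Finset.sum_eq_zero fun m' _ => if_neg ?_
      rintro rfl
      exact hm m'.2
  ext m
  have := hcoeff m.1
  rw [hq0, coeff_zero] at this
  by_cases hm : m ∈ l.support
  · rw [Finset.sum_eq_single m] at this
    · simpa using this.symm
    · intro m' _ hne
      rw [if_neg (fun h => hne (Subtype.ext h))]
    · intro h; exact absurd hm h
  · simpa using hm

/-- Every monomial is congruent to a combination of standard monomials of the same degree. -/
theorem IsLiftable.monomial_mem_span (h : IsLiftable w e f) (m : σ →₀ ℕ) :
    Ideal.Quotient.mkₐ K (Ideal.span (Set.range f)) (monomial m 1) ∈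
      Submodule.span K (Set.range fun s : {s : σ →₀ ℕ // IsStd e s ∧ s.degree = m.degree} =>
        Ideal.Quotient.mkₐ K (Ideal.span (Set.range f)) (monomial s.1 1)) := by
  induction hN : weight w m using Nat.strong_induction_on generalizing m with
  | _ N ih =>
    by_cases hm : IsStd e m
    · exact Submodule.subset_span ⟨⟨m, hm, rfl⟩, rfl⟩
    simp only [IsStd, not_forall, not_not] at hm
    obtain ⟨ρ, hρ⟩ := hm
    obtain ⟨c, hc, h1⟩ := h.lead_mul (m - e ρ) ρ
    rw [tsub_add_cancel_of_le hρ] at h1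
    -- Modulo the ideal, a non-standard monomial equals a multiple of the tail of a relation, which
    -- has smaller weight and the same degree.
    have h2 : Ideal.Quotient.mkₐ K (Ideal.span (Set.range f)) (monomial m 1) =
        -(c⁻¹ • Ideal.Quotient.mkₐ K (Ideal.span (Set.range f))
          (monomial (m - e ρ) 1 * f ρ - c • monomial m 1)) := by
      rw [map_sub, map_smul, smul_sub, inv_smul_smul₀ hc, neg_sub, eq_comm, sub_eq_self,
        smul_eq_zero]
      right
      rw [Ideal.Quotient.mkₐ_eq_mk, Ideal.Quotient.eq_zero_iff_mem]
      exact Ideal.mul_mem_left _ _ (Ideal.subset_span ⟨ρ, rfl⟩)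
    rw [h2]
    refine Submodule.neg_mem _ (Submodule.smul_mem _ _ ?_)
    generalize monomial (m - e ρ) 1 * f ρ - c • monomial m 1 = p at h1
    induction h1 using Submodule.span_induction with
    | mem x hx =>
      obtain ⟨m', h3, h4, rfl⟩ := hx
      have := ih (weight w m') (by omega) m' rfl
      rwa [h4] at this
    | zero => simp
    | add x y _ _ hx hy => rw [map_add]; exact add_mem hx hy
    | smul c x _ hx => rw [map_smul]; exact Submodule.smul_mem _ _ hx

/-- The dimension of a graded piece is the number of standard monomials. -/
theorem IsLiftable.finrank_map_homogeneousSubmodule [Finite σ] (h : IsLiftable w e f) (n : ℕ) :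
    Module.finrank K ((homogeneousSubmodule σ K n).map
      (Ideal.Quotient.mkₐ K (Ideal.span (Set.range f))).toLinearMap) =
    Nat.card {m : σ →₀ ℕ // IsStd e m ∧ m.degree = n} := by
  classical
  have hspan : (homogeneousSubmodule σ K n).map
      (Ideal.Quotient.mkₐ K (Ideal.span (Set.range f))).toLinearMap =
      Submodule.span K (Set.range fun s : {s : σ →₀ ℕ // IsStd e s ∧ s.degree = n} =>
        Ideal.Quotient.mkₐ K (Ideal.span (Set.range f)) (monomial s.1 1)) := by
    apply le_antisymm
    · rintro _ ⟨p, hp, rfl⟩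
      rw [SetLike.mem_coe, mem_homogeneousSubmodule] at hp
      rw [AlgHom.toLinearMap_apply, p.as_sum, map_sum]
      refine Submodule.sum_mem _ fun m hm => ?_
      have hdeg : m.degree = n := by
        rw [Finsupp.degree_eq_weight_one]
        exact hp (MvPolynomial.mem_support_iff.1 hm)
      have : (monomial m (coeff m p) : MvPolynomial σ K) = coeff m p • monomial m 1 := by
        rw [smul_monomial, smul_eq_mul, mul_one]
      rw [this, map_smul]
      have := h.monomial_mem_span m
      rw [hdeg] at this
      exact Submodule.smul_mem _ _ this
    · refine Submodule.span_le.2 ?_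
      rintro _ ⟨s, rfl⟩
      refine ⟨monomial s.1 1, ?_, rfl⟩
      rw [SetLike.mem_coe, mem_homogeneousSubmodule]
      exact isHomogeneous_monomial _ s.2.2
  have hfin : Finite {m : σ →₀ ℕ // IsStd e m ∧ m.degree = n} := by
    refine ((Finsupp.finite_of_degree_le (σ := σ) n).subset ?_ : Set.Finite
      {m : σ →₀ ℕ | IsStd e m ∧ m.degree = n})
    rintro m ⟨-, hm⟩
    exact hm.le
  have := Fintype.ofFinite {m : σ →₀ ℕ // IsStd e m ∧ m.degree = n}
  rw [hspan, Nat.card_eq_fintype_card]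
  refine finrank_span_eq_card ?_
  exact h.linearIndependent.comp
    (fun s : {m : σ →₀ ℕ // IsStd e m ∧ m.degree = n} => ⟨s.1, s.2.1⟩)
    (fun s t hst => Subtype.ext (by simpa using hst))

end StandardMonomials

/-! ### The affine poset as a strip in the plane. -/

namespace QuantumOGr

/-- First coordinate of the embedding of `E` into `ℤ × ℤ`. -/
def Weight.fst : Weight → ℤ
  | .o => 2 | .w12 => 2 | .w13 => 2 | .w14 => 3 | .w23 => 2 | .w15 => 4 | .w24 => 3
  | .w25 => 4 | .w34 => 3 | .w35 => 4 | .p5 => 3 | .w45 => 5 | .p4 => 4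
  | .p3 => 5 | .p2 => 5 | .p1 => 5

/-- Second coordinate of the embedding of `E` into `ℤ × ℤ`. -/
def Weight.snd : Weight → ℤ
  | .o => -2 | .w12 => -1 | .w13 => 0 | .w14 => 0 | .w23 => 1 | .w15 => 0 | .w24 => 1
  | .w25 => 1 | .w34 => 2 | .w35 => 2 | .p5 => 3 | .w45 => 2 | .p4 => 3
  | .p3 => 3 | .p2 => 4 | .p1 => 5

/-- First coordinate of the order embedding of `Ê` into `ℤ × ℤ`. -/
def AffineWeight.fst (a : AffineWeight) : ℤ := 4 * a.level + a.weight.fst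

/-- Second coordinate of the order embedding of `Ê` into `ℤ × ℤ`. -/
def AffineWeight.snd (a : AffineWeight) : ℤ := 4 * a.level + a.weight.snd

theorem AffineWeight.ht_eq (a : AffineWeight) : a.ht = a.fst + a.snd := by
  obtain ⟨α, l⟩ := a
  cases α <;> simp only [AffineWeight.ht, AffineWeight.fst, AffineWeight.snd, Weight.ht,
    Weight.fst, Weight.snd] <;> ring

theorem AffineArrow.coord_le {a b : AffineWeight} (h : AffineArrow a b) :
    a.fst ≤ b.fst ∧ a.snd ≤ b.snd := by
  rcases h with ⟨h, l⟩ | ⟨h, l⟩ <;> cases h <;>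
    simp only [AffineWeight.fst, AffineWeight.snd, Weight.fst, Weight.snd] <;> omega

/-- The image of `Ê` in `ℤ × ℤ` lies in a strip with every second boundary point removed. -/
theorem AffineWeight.strip (a : AffineWeight) :
    0 ≤ a.fst - a.snd ∧ a.fst - a.snd ≤ 4 ∧ (a.fst - a.snd = 0 → a.fst % 2 = 1) ∧
      (a.fst - a.snd = 4 → a.fst % 2 = 0) := by
  obtain ⟨α, l⟩ := a
  cases α <;> simp only [AffineWeight.fst, AffineWeight.snd, Weight.fst, Weight.snd] <;> omega

theorem AffineWeight.coord_injective {a b : AffineWeight} (h1 : a.fst = b.fst)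
    (h2 : a.snd = b.snd) : a = b := by
  obtain ⟨α, l⟩ := a
  obtain ⟨β, m⟩ := b
  cases α <;> cases β <;>
    simp only [AffineWeight.fst, AffineWeight.snd, Weight.fst, Weight.snd] at h1 h2 <;>
    first
    | (exfalso; omega)
    | (obtain rfl : l = m := by omega
       rfl)

/-- Each arrow raises exactly one coordinate by one. Where two arrows leave `a`, the first
coordinate is raised if there is room, otherwise the second. Where only one leaves, the missing
neighbour lies outside the strip or is a removed boundary point, and the strip conditions on `b`
leave room for the remaining arrow. -/
theorem AffineWeight.exists_arrow {a b : AffineWeight} (hne : a ≠ b) (h1 : a.fst ≤ b.fst)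
    (h2 : a.snd ≤ b.snd) : ∃ c, AffineArrow a c ∧ c.fst ≤ b.fst ∧ c.snd ≤ b.snd := by
  have hs := b.strip
  have hne' : ¬ (a.fst = b.fst ∧ a.snd = b.snd) := fun h => hne (coord_injective h.1 h.2)
  generalize b.fst = x at *
  generalize b.snd = y at *
  obtain ⟨α, l⟩ := a
  have key : ∃ c, AffineArrow ⟨α, l⟩ c ∧ c.fst ≤ x ∧ c.snd ≤ y := by
    have same : ∀ {β}, Arrow α β → 4 * l + β.fst ≤ x → 4 * l + β.snd ≤ y →
        ∃ c, AffineArrow ⟨α, l⟩ c ∧ c.fst ≤ x ∧ c.snd ≤ y :=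
      fun {β} h h1 h2 => ⟨⟨β, l⟩, .same h l, h1, h2⟩
    have next : ∀ {β}, LoopArrow α β → 4 * (l + 1) + β.fst ≤ x → 4 * (l + 1) + β.snd ≤ y →
        ∃ c, AffineArrow ⟨α, l⟩ c ∧ c.fst ≤ x ∧ c.snd ≤ y :=
      fun {β} h h1 h2 => ⟨⟨β, l + 1⟩, .next h l, h1, h2⟩
    simp only [AffineWeight.fst, AffineWeight.snd] at h1 h2 hne'
    cases α <;> simp only [Weight.fst, Weight.snd] at h1 h2 hne'
    · exact same .o_12 (by simp only [Weight.fst]; omega) (by simp only [Weight.snd]; omega)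
    · exact same .a12_13 (by simp only [Weight.fst]; omega) (by simp only [Weight.snd]; omega)
    · by_cases h : 4 * l + 3 ≤ x
      · exact same .a13_14 (by simp only [Weight.fst]; omega) (by simp only [Weight.snd]; omega)
      · exact same .a13_23 (by simp only [Weight.fst]; omega) (by simp only [Weight.snd]; omega)
    · by_cases h : 4 * l + 4 ≤ x
      · exact same .a14_15 (by simp only [Weight.fst]; omega) (by simp only [Weight.snd]; omega)
      · exact same .a14_24 (by simp only [Weight.fst]; omega) (by simp only [Weight.snd]; omega)
    · exact same .a15_25 (by simp only [Weight.fst]; omega) (by simp only [Weight.snd]; omega)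
    · exact same .a23_24 (by simp only [Weight.fst]; omega) (by simp only [Weight.snd]; omega)
    · by_cases h : 4 * l + 4 ≤ x
      · exact same .a24_25 (by simp only [Weight.fst]; omega) (by simp only [Weight.snd]; omega)
      · exact same .a24_34 (by simp only [Weight.fst]; omega) (by simp only [Weight.snd]; omega)
    · exact same .a25_35 (by simp only [Weight.fst]; omega) (by simp only [Weight.snd]; omega)
    · by_cases h : 4 * l + 4 ≤ x
      · exact same .a34_35 (by simp only [Weight.fst]; omega) (by simp only [Weight.snd]; omega)
      · exact same .a34_5 (by simp only [Weight.fst]; omega) (by simp only [Weight.snd]; omega)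
    · by_cases h : 4 * l + 5 ≤ x
      · exact same .a35_45 (by simp only [Weight.fst]; omega) (by simp only [Weight.snd]; omega)
      · exact same .a35_4 (by simp only [Weight.fst]; omega) (by simp only [Weight.snd]; omega)
    · by_cases h : 4 * l + 6 ≤ x
      · exact next .a45_o (by simp only [Weight.fst]; omega) (by simp only [Weight.snd]; omega)
      · exact same .a45_3 (by simp only [Weight.fst]; omega) (by simp only [Weight.snd]; omega)
    · exact next .a1_23 (by simp only [Weight.fst]; omega) (by simp only [Weight.snd]; omega)
    · by_cases h : 4 * l + 6 ≤ x
      · exact next .a2_13 (by simp only [Weight.fst]; omega) (by simp only [Weight.snd]; omega)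
      · exact same .a2_1 (by simp only [Weight.fst]; omega) (by simp only [Weight.snd]; omega)
    · by_cases h : 4 * l + 6 ≤ x
      · exact next .a3_12 (by simp only [Weight.fst]; omega) (by simp only [Weight.snd]; omega)
      · exact same .a3_2 (by simp only [Weight.fst]; omega) (by simp only [Weight.snd]; omega)
    · exact same .a4_3 (by simp only [Weight.fst]; omega) (by simp only [Weight.snd]; omega)
    · exact same .a5_4 (by simp only [Weight.fst]; omega) (by simp only [Weight.snd]; omega)
  exact key

/-- The order on `Ê` is the product order in the coordinates. -/
theorem AffineWeight.le_iff {a b : AffineWeight} : a ≤ b ↔ a.fst ≤ b.fst ∧ a.snd ≤ b.snd := by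
  constructor
  · intro h
    change Relation.ReflTransGen AffineArrow a b at h
    induction h with
    | refl => exact ⟨le_rfl, le_rfl⟩
    | tail _ hbc ih => exact ⟨ih.1.trans hbc.coord_le.1, ih.2.trans hbc.coord_le.2⟩
  · rintro ⟨h1, h2⟩
    change Relation.ReflTransGen AffineArrow a b
    induction hn : (b.ht - a.ht).toNat using Nat.strong_induction_on generalizing a with
    | _ n ih =>
      by_cases hab : a = b
      · rw [hab]
      obtain ⟨c, hac, h3, h4⟩ := exists_arrow hab h1 h2
      refine Relation.ReflTransGen.head hac (ih _ ?_ h3 h4 rfl)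
      have := hac.ht_eq
      have := b.ht_eq
      have := c.ht_eq
      omega

theorem AffineWeight.lt_iff {a b : AffineWeight} :
    a < b ↔ a.fst ≤ b.fst ∧ a.snd ≤ b.snd ∧ ¬ (a.fst = b.fst ∧ a.snd = b.snd) := by
  rw [lt_iff_le_and_ne, le_iff, and_assoc]
  refine and_congr_right fun _ => and_congr_right fun _ => not_congr ?_
  exact ⟨fun h => h ▸ ⟨rfl, rfl⟩, fun h => coord_injective h.1 h.2⟩

end QuantumOGr

/-! ### Leading terms of the relations and incomparable pairs. -/

namespace QuantumOGr

instance : Fintype VectorIndex where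
  elems := {.v1, .v2, .v3, .v4, .v5, .s1, .s2, .s3, .s4, .s5}
  complete x := by cases x <;> decide

/-- The signed terms of the pure spinor quadrics. -/
def quadTerm : VectorIndex → Fin 4 → ℤ × Weight × Weight
  | .v1 => ![(1, .w25, .w34), (1, .p1, .o), (-1, .w24, .w35), (1, .w23, .w45)]
  | .v2 => ![(-1, .w15, .w34), (-1, .p2, .o), (1, .w14, .w35), (-1, .w13, .w45)]
  | .v3 => ![(1, .w15, .w24), (1, .p3, .o), (-1, .w14, .w25), (1, .w12, .w45)]
  | .v4 => ![(-1, .w15, .w23), (-1, .p4, .o), (1, .w13, .w25), (-1, .w12, .w35)]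
  | .v5 => ![(1, .w14, .w23), (1, .p5, .o), (-1, .w13, .w24), (1, .w12, .w34)]
  | .s1 => ![(1, .p5, .w15), (-1, .p2, .w12), (1, .p3, .w13), (-1, .p4, .w14)]
  | .s2 => ![(1, .p5, .w25), (-1, .p1, .w12), (1, .p3, .w23), (-1, .p4, .w24)]
  | .s3 => ![(1, .p5, .w35), (-1, .p1, .w13), (1, .p2, .w23), (-1, .p4, .w34)]
  | .s4 => ![(1, .p5, .w45), (-1, .p1, .w14), (1, .p2, .w24), (-1, .p3, .w34)]
  | .s5 => ![(1, .p4, .w45), (-1, .p1, .w15), (1, .p2, .w25), (-1, .p3, .w35)]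

/-- The signed terms of the sixteen linear syzygies of the pure spinor quadrics, the components of
the equivariant map from `V ⊗ S` to the dual half-spin representation. -/
def syzTerm : Weight → Fin 5 → ℤ × VectorIndex × Weight
  | .o => ![(1, .s1, .p1), (-1, .s2, .p2), (1, .s3, .p3), (-1, .s4, .p4), (1, .s5, .p5)]
  | .w12 => ![(1, .v1, .p2), (1, .v2, .p1), (-1, .s3, .w45), (1, .s4, .w35), (-1, .s5, .w34)]
  | .w13 => ![(1, .v1, .p3), (-1, .s2, .w45), (-1, .v3, .p1), (1, .s4, .w25), (-1, .s5, .w24)]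
  | .w14 => ![(1, .v1, .p4), (-1, .s2, .w35), (1, .s3, .w25), (1, .v4, .p1), (-1, .s5, .w23)]
  | .w15 => ![(1, .v1, .p5), (-1, .s2, .w34), (1, .s3, .w24), (-1, .s4, .w23), (-1, .v5, .p1)]
  | .w23 => ![(1, .s1, .w45), (1, .v2, .p3), (1, .v3, .p2), (-1, .s4, .w15), (1, .s5, .w14)]
  | .w24 => ![(1, .s1, .w35), (1, .v2, .p4), (-1, .s3, .w15), (-1, .v4, .p2), (1, .s5, .w13)]
  | .w25 => ![(1, .s1, .w34), (1, .v2, .p5), (-1, .s3, .w14), (1, .s4, .w13), (1, .v5, .p2)]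
  | .w34 => ![(1, .s1, .w25), (-1, .s2, .w15), (-1, .v3, .p4), (-1, .v4, .p3), (1, .s5, .w12)]
  | .w35 => ![(1, .s1, .w24), (-1, .s2, .w14), (-1, .v3, .p5), (1, .s4, .w12), (1, .v5, .p3)]
  | .w45 => ![(1, .s1, .w23), (-1, .s2, .w13), (1, .s3, .w12), (1, .v4, .p5), (1, .v5, .p4)]
  | .p1 => ![(1, .s1, .o), (-1, .v2, .w12), (-1, .v3, .w13), (-1, .v4, .w14), (-1, .v5, .w15)]
  | .p2 => ![(1, .v1, .w12), (1, .s2, .o), (-1, .v3, .w23), (-1, .v4, .w24), (-1, .v5, .w25)]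
  | .p3 => ![(1, .v1, .w13), (1, .v2, .w23), (1, .s3, .o), (-1, .v4, .w34), (-1, .v5, .w35)]
  | .p4 => ![(1, .v1, .w14), (1, .v2, .w24), (1, .v3, .w34), (1, .s4, .o), (-1, .v5, .w45)]
  | .p5 => ![(1, .v1, .w15), (1, .v2, .w25), (1, .v3, .w35), (1, .v4, .w45), (1, .s5, .o)]

theorem pureSpinorQuadric_eq_sum {R : Type*} [CommRing R] (x : Weight → R) (s : VectorIndex) :
    pureSpinorQuadric x s =
      ∑ j, (quadTerm s j).1 • (x (quadTerm s j).2.1 * x (quadTerm s j).2.2) := by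
  cases s <;> simp [pureSpinorQuadric, quadTerm, Fin.sum_univ_four] <;> ring

theorem linear_syzygy {R : Type*} [CommRing R] (x : Weight → R) (c : Weight) :
    ∑ k, (syzTerm c k).1 • (x (syzTerm c k).2.2 * pureSpinorQuadric x (syzTerm c k).2.1) = 0 := by
  cases c <;> simp [pureSpinorQuadric, syzTerm, Fin.sum_univ_five] <;> ring

/-- The index of the leading term of a relation, depending on the parity of the level. -/
def leadIdx (l : ℤ) : Fin 4 := if l % 2 = 0 then 0 else 1

/-- The first factor of the leading term of `relation a b s l`. -/
def leadL (s : VectorIndex) (l : ℤ) : AffineWeight := ⟨(quadTerm s (leadIdx l)).2.1, l / 2⟩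

/-- The second factor of the leading term of `relation a b s l`. -/
def leadR (s : VectorIndex) (l : ℤ) : AffineWeight :=
  ⟨(quadTerm s (leadIdx l)).2.2, l / 2 + l % 2⟩

/-- Translation of levels. -/
def AffineWeight.shift (k : ℤ) (a : AffineWeight) : AffineWeight := ⟨a.weight, a.level + k⟩

theorem AffineWeight.ht_shift (k : ℤ) (a : AffineWeight) : (a.shift k).ht = a.ht + 8 * k := by
  simp only [AffineWeight.ht, AffineWeight.shift]; ring

/-- Raising the level of both factors by `k` raises the level of a quadric by `2 * k`. This
periodicity is what turns statements about all levels into finite checks. -/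
theorem leadIdx_add (k l : ℤ) : leadIdx (2 * k + l) = leadIdx l := by
  have : (2 * k + l) % 2 = l % 2 := by omega
  simp only [leadIdx, this]

theorem leadL_add (s : VectorIndex) (k l : ℤ) : leadL s (2 * k + l) = (leadL s l).shift k := by
  simp only [leadL, leadIdx_add, AffineWeight.shift]
  congr 1
  omega

theorem leadR_add (s : VectorIndex) (k l : ℤ) : leadR s (2 * k + l) = (leadR s l).shift k := by
  simp only [leadR, leadIdx_add, AffineWeight.shift]
  congr 1
  omega

/-- The factors of the leading term are incomparable. -/
theorem lead_incomparable (s : VectorIndex) (l : ℤ) :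
    ¬ leadL s l ≤ leadR s l ∧ ¬ leadR s l ≤ leadL s l := by
  rw [AffineWeight.le_iff, AffineWeight.le_iff]
  obtain ⟨k, h | h⟩ : ∃ k, l = 2 * k + 0 ∨ l = 2 * k + 1 := ⟨l / 2, by omega⟩ <;> subst h <;>
    rw [leadL_add, leadR_add] <;> cases s <;>
    simp [leadL, leadR, leadIdx, quadTerm, AffineWeight.shift, AffineWeight.fst, AffineWeight.snd,
      Weight.fst, Weight.snd] <;> omega

/-- All incomparable pairs are leading terms. -/
theorem exists_lead_of_incomparable {a b : AffineWeight} (h1 : ¬ a ≤ b) (h2 : ¬ b ≤ a) :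
    ∃ s l, (leadL s l = a ∧ leadR s l = b) ∨ (leadL s l = b ∧ leadR s l = a) := by
  wlog h : a.fst < b.fst generalizing a b
  · obtain ⟨s, l, h'⟩ := this h2 h1 (by
      rw [AffineWeight.le_iff] at h1 h2
      omega)
    exact ⟨s, l, h'.symm⟩
  have h3 : b.snd < a.snd := by
    rw [AffineWeight.le_iff] at h1
    omega
  clear h1 h2
  obtain ⟨α, i⟩ := a
  obtain ⟨β, j⟩ := b
  have key : ∀ s l, (leadL s l = ⟨α, 0⟩ ∧ leadR s l = ⟨β, j - i⟩) ∨
      (leadL s l = ⟨β, j - i⟩ ∧ leadR s l = ⟨α, 0⟩) → ∃ s l,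
      (leadL s l = ⟨α, i⟩ ∧ leadR s l = ⟨β, j⟩) ∨ (leadL s l = ⟨β, j⟩ ∧ leadR s l = ⟨α, i⟩) := by
    intro s l h
    refine ⟨s, 2 * i + l, ?_⟩
    rw [leadL_add, leadR_add]
    rcases h with ⟨h1, h2⟩ | ⟨h1, h2⟩
    · left; rw [h1, h2]; simp [AffineWeight.shift]
    · right; rw [h1, h2]; simp [AffineWeight.shift]
  -- Coordinates of weights at a fixed level range over bounded intervals, so elements at distant
  -- levels are comparable.
  have hb : -1 ≤ j - i ∧ j - i ≤ 1 := by
    cases α <;> simp only [AffineWeight.fst, AffineWeight.snd, Weight.fst, Weight.snd] at h h3 <;>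
      cases β <;> simp only at h h3 <;> omega
  have hf : α.fst < 4 * (j - i) + β.fst ∧ 4 * (j - i) + β.snd < α.snd := by
    simp only [AffineWeight.fst, AffineWeight.snd] at h h3
    omega
  clear h h3
  have table : ∀ (α β : Weight) (t : Fin 3), α.fst < 4 * ((t : ℤ) - 1) + β.fst →
      4 * ((t : ℤ) - 1) + β.snd < α.snd → ∃ (s : VectorIndex) (l : Fin 4),
      (leadL s ((l : ℤ) - 2) = ⟨α, 0⟩ ∧ leadR s ((l : ℤ) - 2) = ⟨β, (t : ℤ) - 1⟩) ∨
      (leadL s ((l : ℤ) - 2) = ⟨β, (t : ℤ) - 1⟩ ∧ leadR s ((l : ℤ) - 2) = ⟨α, 0⟩) := by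
    decide +kernel
  obtain ⟨t, ht⟩ : ∃ t : Fin 3, (t : ℤ) - 1 = j - i := by
    refine ⟨⟨(j - i + 1).toNat, by omega⟩, ?_⟩
    simp only
    omega
  obtain ⟨s, l, h⟩ := table α β t (by rw [ht]; exact hf.1) (by rw [ht]; exact hf.2)
  rw [ht] at h
  exact key s _ h

theorem Weight.coord_bounds (α : Weight) :
    2 ≤ α.fst ∧ α.fst ≤ 5 ∧ -2 ≤ α.snd ∧ α.snd ≤ 5 := by
  cases α <;> simp [Weight.fst, Weight.snd]

theorem AffineWeight.shift_le_shift {a b : AffineWeight} (k : ℤ) :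
    a.shift k ≤ b.shift k ↔ a ≤ b := by
  simp only [le_iff, AffineWeight.fst, AffineWeight.snd, AffineWeight.shift]
  omega

/-- For small `|i|` this is a finite table. For `|i| ≥ 4` the two factors lie so far apart in level
that the coordinate bounds alone place them on either side of the leading pair. -/
theorem nested_terms_of_parity (s : VectorIndex) (e : Fin 2) (i : ℤ) (j : Fin 4) :
    (j = leadIdx e ∧ i = 0) ∨
      ∀ u v : AffineWeight, u = ⟨(quadTerm s j).2.1, i⟩ → v = ⟨(quadTerm s j).2.2, e - i⟩ →
        (u ≤ leadL s e ∧ u ≤ leadR s e ∧ leadL s e ≤ v ∧ leadR s e ≤ v) ∨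
        (v ≤ leadL s e ∧ v ≤ leadR s e ∧ leadL s e ≤ u ∧ leadR s e ≤ u) := by
  rw [or_iff_not_imp_left]
  rintro h u v rfl rfl
  simp only [AffineWeight.le_iff]
  by_cases hi : -3 ≤ i ∧ i ≤ 3
  -- Quantifying over singleton lists names `u` and `v` while keeping the statement decidable.
  · have table : ∀ (s : VectorIndex) (e : Fin 2) (t : Fin 7) (j : Fin 4),
        ¬ (j = leadIdx e ∧ (t : ℤ) - 3 = 0) →
        ∀ u ∈ [(⟨(quadTerm s j).2.1, (t : ℤ) - 3⟩ : AffineWeight)],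
        ∀ v ∈ [(⟨(quadTerm s j).2.2, e - ((t : ℤ) - 3)⟩ : AffineWeight)],
        ((u.fst ≤ (leadL s e).fst ∧ u.snd ≤ (leadL s e).snd) ∧
          (u.fst ≤ (leadR s e).fst ∧ u.snd ≤ (leadR s e).snd) ∧
          ((leadL s e).fst ≤ v.fst ∧ (leadL s e).snd ≤ v.snd) ∧
          ((leadR s e).fst ≤ v.fst ∧ (leadR s e).snd ≤ v.snd)) ∨
        ((v.fst ≤ (leadL s e).fst ∧ v.snd ≤ (leadL s e).snd) ∧
          (v.fst ≤ (leadR s e).fst ∧ v.snd ≤ (leadR s e).snd) ∧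
          ((leadL s e).fst ≤ u.fst ∧ (leadL s e).snd ≤ u.snd) ∧
          ((leadR s e).fst ≤ u.fst ∧ (leadR s e).snd ≤ u.snd)) := by
      decide +kernel
    obtain ⟨t, ht⟩ : ∃ t : Fin 7, (t : ℤ) - 3 = i :=
      ⟨⟨(i + 3).toNat, by omega⟩, by simp only; omega⟩
    subst ht
    exact table s e t j h _ (List.mem_singleton_self _) _ (List.mem_singleton_self _)
  · have h1 := (quadTerm s j).2.1.coord_bounds
    have h2 := (quadTerm s j).2.2.coord_bounds
    have h3 := (quadTerm s (leadIdx e)).2.1.coord_bounds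
    have h4 := (quadTerm s (leadIdx e)).2.2.coord_bounds
    have he : (e : ℤ) = 0 ∨ (e : ℤ) = 1 := by omega
    simp only [AffineWeight.fst, AffineWeight.snd, leadL, leadR]
    by_cases hi' : 0 ≤ i
    · right; refine ⟨⟨?_, ?_⟩, ⟨?_, ?_⟩, ⟨?_, ?_⟩, ⟨?_, ?_⟩⟩ <;> omega
    · left; refine ⟨⟨?_, ?_⟩, ⟨?_, ?_⟩, ⟨?_, ?_⟩, ⟨?_, ?_⟩⟩ <;> omega

/-- The terms of a relation other than the leading one are nested around it. -/
theorem nested_terms (s : VectorIndex) (l i : ℤ) (j : Fin 4) :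
    (j = leadIdx l ∧ i = l / 2) ∨
      ∃ u v : AffineWeight,
        ((u = ⟨(quadTerm s j).2.1, i⟩ ∧ v = ⟨(quadTerm s j).2.2, l - i⟩) ∨
          (v = ⟨(quadTerm s j).2.1, i⟩ ∧ u = ⟨(quadTerm s j).2.2, l - i⟩)) ∧
        u ≤ leadL s l ∧ u ≤ leadR s l ∧ leadL s l ≤ v ∧ leadR s l ≤ v := by
  obtain ⟨k, e, rfl⟩ : ∃ (k : ℤ) (e : Fin 2), l = 2 * k + e :=
    ⟨l / 2, ⟨(l % 2).toNat, by omega⟩, by simp only; omega⟩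
  rw [leadIdx_add, leadL_add, leadR_add]
  rcases nested_terms_of_parity s e (i - k) j with h | h
  · left
    exact ⟨h.1, by omega⟩
  · right
    have e1 : (⟨(quadTerm s j).2.1, i⟩ : AffineWeight) =
      AffineWeight.shift k ⟨(quadTerm s j).2.1, i - k⟩ := by simp [AffineWeight.shift]
    have e2 : (⟨(quadTerm s j).2.2, 2 * k + e - i⟩ : AffineWeight) =
        AffineWeight.shift k ⟨(quadTerm s j).2.2, e - (i - k)⟩ := by
      simp only [AffineWeight.shift]; congr 1; ring
    rw [e1, e2]
    rcases h _ _ rfl rfl with h' | h'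
    · refine ⟨_, _, Or.inl ⟨rfl, rfl⟩, ?_⟩
      simpa only [AffineWeight.shift_le_shift] using h'
    · refine ⟨_, _, Or.inr ⟨rfl, rfl⟩, ?_⟩
      simpa only [AffineWeight.shift_le_shift] using h'

/-- Every quadric is homogeneous for the grading by height; moving a level from one factor to the
other does not change the sum. -/
theorem ht_terms (s : VectorIndex) (l i : ℤ) (j : Fin 4) :
    (⟨(quadTerm s j).2.1, i⟩ : AffineWeight).ht + (⟨(quadTerm s j).2.2, l - i⟩ : AffineWeight).ht =
      (leadL s l).ht + (leadR s l).ht := by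
  have h : ∀ s j j', (quadTerm s j).2.1.ht + (quadTerm s j).2.2.ht =
    (quadTerm s j').2.1.ht + (quadTerm s j').2.2.ht := by decide +kernel
  have := h s j (leadIdx l)
  simp only [AffineWeight.ht, leadL, leadR]
  omega

end QuantumOGr

/-! ### S-pairs with a common variable and the linear syzygies. -/

namespace QuantumOGr

/-- The sum of the squares of the heights of the leading monomial of a term of a syzygy. -/
def sqHt (b : AffineWeight) (s : VectorIndex) (l : ℤ) : ℤ :=
  b.ht * b.ht + (leadL s l).ht * (leadL s l).ht + (leadR s l).ht * (leadR s l).ht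

/-- The two factors of a leading term. -/
def leadSide (s : VectorIndex) (l : ℤ) (p : Bool) : AffineWeight :=
  if p then leadL s l else leadR s l

set_option maxRecDepth 100000 in
-- The finite core of Buchberger's criterion: the S-pair occurs as two of the terms of a linear
-- syzygy, and every other term has a larger sum of squared heights, that is, smaller weight. The
-- bound `1600` disposes of the levels outside the range of `j`.
theorem shared_table : ∀ (s s' : VectorIndex) (l : Fin 2) (m : Fin 6) (p p' : Bool),
    leadSide s l p = leadSide s' ((m : ℤ) - 2) p' → (s = s' ∧ (l : ℤ) = (m : ℤ) - 2) ∨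
    ∃ (c : Weight) (k₁ : Fin 5), (syzTerm c k₁).2 = (s, (leadSide s' ((m : ℤ) - 2) !p').weight) ∧
    ∃ k₂ : Fin 5, (syzTerm c k₂).2 = (s', (leadSide s l !p).weight) ∧ k₁ ≠ k₂ ∧
      (leadSide s' ((m : ℤ) - 2) !p').level + l = (leadSide s l !p).level + ((m : ℤ) - 2) ∧
      sqHt (leadSide s' ((m : ℤ) - 2) !p') s l ≤ 1600 ∧
      ∀ (k : Fin 5) (j : Fin 13),
        (k = k₁ ∧ (j : ℤ) - 6 = (leadSide s' ((m : ℤ) - 2) !p').level) ∨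
        (k = k₂ ∧ (j : ℤ) - 6 = (leadSide s l !p).level) ∨
        sqHt (leadSide s' ((m : ℤ) - 2) !p') s l <
          sqHt ⟨(syzTerm c k).2.2, (j : ℤ) - 6⟩ (syzTerm c k).2.1
            ((leadSide s' ((m : ℤ) - 2) !p').level + l - ((j : ℤ) - 6)) := by
  decide +kernel

end QuantumOGr

/-! ### Translation to arbitrary levels, and coefficients of Laurent polynomials. -/

namespace QuantumOGr

theorem AffineWeight.ht_lt_ht {a b : AffineWeight} (h : a < b) : a.ht < b.ht := by
  rw [lt_iff] at h
  rw [ht_eq, ht_eq]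
  omega

theorem leadSide_add (s : VectorIndex) (k l : ℤ) (p : Bool) :
    leadSide s (2 * k + l) p = (leadSide s l p).shift k := by
  cases p <;> simp [leadSide, leadL_add, leadR_add]

theorem ht_lead_add (s : VectorIndex) (l : ℤ) :
    (leadL s l).ht + (leadR s l).ht = 8 * l + ((quadTerm s 0).2.1.ht + (quadTerm s 0).2.2.ht) := by
  rw [← ht_terms s l 0 0]
  simp only [AffineWeight.ht]
  ring

theorem ht_syzTerm (c : Weight) (k k' : Fin 5) (l i i' : ℤ) :
    (⟨(syzTerm c k).2.2, i⟩ : AffineWeight).ht +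
        ((leadL (syzTerm c k).2.1 (l - i)).ht + (leadR (syzTerm c k).2.1 (l - i)).ht) =
      (⟨(syzTerm c k').2.2, i'⟩ : AffineWeight).ht +
        ((leadL (syzTerm c k').2.1 (l - i')).ht + (leadR (syzTerm c k').2.1 (l - i')).ht) := by
  have h : ∀ c k k', (syzTerm c k).2.2.ht + ((quadTerm (syzTerm c k).2.1 0).2.1.ht +
      (quadTerm (syzTerm c k).2.1 0).2.2.ht) = (syzTerm c k').2.2.ht +
      ((quadTerm (syzTerm c k').2.1 0).2.1.ht + (quadTerm (syzTerm c k').2.1 0).2.2.ht) := by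
    decide +kernel
  have := h c k k'
  rw [ht_lead_add, ht_lead_add]
  simp only [AffineWeight.ht]
  omega

theorem Weight.ht_bounds (α : Weight) : 0 ≤ α.ht ∧ α.ht ≤ 10 := by
  cases α <;> simp [Weight.ht]

/-- The correction depends only on `k` and the total height, which all terms of a syzygy share by
`ht_syzTerm`; comparisons of `sqHt` between them are thus invariant under translation. -/
theorem sqHt_shift (b : AffineWeight) (s : VectorIndex) (l k : ℤ) :
    sqHt (b.shift k) s (2 * k + l) = sqHt b s l +
      16 * k * (b.ht + ((leadL s l).ht + (leadR s l).ht)) + 192 * k ^ 2 := by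
  simp only [sqHt, leadL_add, leadR_add, AffineWeight.ht_shift]
  ring

/-- Two distinct relations whose leading terms share a factor are linked by a linear syzygy in
which all other terms are of larger weight. -/
theorem exists_syzygy {s s' : VectorIndex} {l l' : ℤ} {p p' : Bool}
    (h : leadSide s l p = leadSide s' l' p') (hne : ¬ (s = s' ∧ l = l')) :
    ∃ (c : Weight) (k₁ k₂ : Fin 5), k₁ ≠ k₂ ∧
      (syzTerm c k₁).2 = (s, (leadSide s' l' !p').weight) ∧
      (syzTerm c k₂).2 = (s', (leadSide s l !p).weight) ∧
      (leadSide s' l' !p').level + l = (leadSide s l !p).level + l' ∧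
      ∀ (k : Fin 5) (i : ℤ), (k = k₁ ∧ i = (leadSide s' l' !p').level) ∨
        (k = k₂ ∧ i = (leadSide s l !p).level) ∨
        sqHt (leadSide s' l' !p') s l <
          sqHt ⟨(syzTerm c k).2.2, i⟩ (syzTerm c k).2.1 ((leadSide s' l' !p').level + l - i) := by
  obtain ⟨K, e, rfl⟩ : ∃ (K : ℤ) (e : Fin 2), l = 2 * K + e :=
    ⟨l / 2, ⟨(l % 2).toNat, by omega⟩, by simp only; omega⟩
  -- After translation by `K` the common factor has level `0` or `1`, which confines `l'` to the
  -- range of the table.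
  obtain ⟨m, rfl⟩ : ∃ m : Fin 6, l' = 2 * K + ((m : ℤ) - 2) := by
    have h1 := congrArg AffineWeight.level h
    have h2 : 0 ≤ l' - 2 * K + 2 ∧ l' - 2 * K + 2 ≤ 5 := by
      cases p <;> cases p' <;> simp [leadSide, leadL, leadR] at h1 <;> omega
    exact ⟨⟨(l' - 2 * K + 2).toNat, by omega⟩, by simp only; omega⟩
  rw [leadSide_add, leadSide_add] at h
  have h0 : leadSide s e p = leadSide s' ((m : ℤ) - 2) p' := by
    simpa [AffineWeight.shift, AffineWeight.ext_iff] using h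
  simp only [leadSide_add]
  obtain h1 | ⟨c, k₁, hk₁, k₂, hk₂, hk, hlev, hb, hall⟩ := shared_table s s' e m p p' h0
  · exact absurd ⟨h1.1, by omega⟩ hne
  refine ⟨c, k₁, k₂, hk, hk₁, hk₂, ?_, fun k i => ?_⟩
  · simp only [AffineWeight.shift]; omega
  set z := leadSide s' ((m : ℤ) - 2) !p'
  set y := leadSide s e !p
  have key : (k = k₁ ∧ i - K = z.level) ∨ (k = k₂ ∧ i - K = y.level) ∨
      sqHt z s e < sqHt ⟨(syzTerm c k).2.2, i - K⟩ (syzTerm c k).2.1 (z.level + e - (i - K)) := by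
    by_cases hi : 0 ≤ i - K + 6 ∧ i - K + 6 ≤ 12
    · obtain ⟨j, hj⟩ : ∃ j : Fin 13, (j : ℤ) - 6 = i - K :=
        ⟨⟨(i - K + 6).toNat, by omega⟩, by simp only; omega⟩
      have := hall k j
      rwa [hj] at this
    · right; right
      -- Here `|i - K| ≥ 7`, so the height of the linear factor is at least `56` or at most `-46`,
      -- and its square alone exceeds `1600`.
      refine lt_of_le_of_lt hb ?_
      have h3 := (syzTerm c k).2.2.ht_bounds
      have h4 : 1600 < (⟨(syzTerm c k).2.2, i - K⟩ : AffineWeight).ht *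
          (⟨(syzTerm c k).2.2, i - K⟩ : AffineWeight).ht := by
        simp only [AffineWeight.ht]
        by_cases hi' : 0 ≤ i - K
        · have h5 : 56 ≤ 8 * (i - K) + (syzTerm c k).2.2.ht := by omega
          nlinarith
        · have h5 : 8 * (i - K) + (syzTerm c k).2.2.ht ≤ -46 := by omega
          nlinarith
      rw [sqHt]
      nlinarith [mul_self_nonneg (leadL (syzTerm c k).2.1 (z.level + e - (i - K))).ht,
        mul_self_nonneg (leadR (syzTerm c k).2.1 (z.level + e - (i - K))).ht]
  rcases key with h1 | h1 | h1
  · left; exact ⟨h1.1, by simp only [AffineWeight.shift]; omega⟩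
  · right; left; exact ⟨h1.1, by simp only [AffineWeight.shift]; omega⟩
  · right; right
    have e1 : (⟨(syzTerm c k).2.2, i⟩ : AffineWeight) =
      AffineWeight.shift K ⟨(syzTerm c k).2.2, i - K⟩ := by simp [AffineWeight.shift]
    have e2 : (z.shift K).level + (2 * K + e) - i = 2 * K + (z.level + e - (i - K)) := by
      simp only [AffineWeight.shift]; ring
    rw [e1, e2, sqHt_shift, sqHt_shift]
    have h5 := ht_syzTerm c k k₁ (z.level + e) (i - K) z.level
    rw [hk₁] at h5
    have e3 : z.level + e - z.level = e := by ring
    simp only [e3] at h5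
    rw [h5]
    linarith

/-- The variable `λ^c`, or zero when `c` is not in the interval. -/
noncomputable def gen (a b c : AffineWeight) : PolyRing a b :=
  open Classical in if h : c ∈ Set.Icc a b then MvPolynomial.X ⟨c, h⟩ else 0

theorem coeff_genFun (a b : AffineWeight) (α : Weight) (l : ℤ) :
    (genFun a b α).coeff l = gen a b ⟨α, l⟩ := by
  classical
  rw [genFun, AddMonoidAlgebra.coeff_sum, Finsupp.finsetSum_apply]
  have h1 (i : Set.Icc a b) : (LaurentPolynomial.C (MvPolynomial.X i : PolyRing a b) *
      LaurentPolynomial.T i.1.level).coeff l = if i.1.level = l then MvPolynomial.X i else 0 := by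
    rw [← LaurentPolynomial.single_eq_C_mul_T, AddMonoidAlgebra.coeff_single,
      Finsupp.single_apply]
  simp only [h1]
  rw [gen]
  split_ifs with h
  · rw [Finset.sum_eq_single ⟨⟨α, l⟩, h⟩]
    · simp
    · intro i hi hne
      refine if_neg fun hl => hne (Subtype.ext (AffineWeight.ext ?_ hl))
      exact (Finset.mem_filter.1 hi).2
    · intro h'
      simp at h'
  · refine Finset.sum_eq_zero fun i hi => if_neg fun hl => h ?_
    have : i.1 = ⟨α, l⟩ := AffineWeight.ext (Finset.mem_filter.1 hi).2 hl
    rw [← this]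
    exact i.2

section Laurent

variable {K R : Type*} [Field K] [CommRing R] [Algebra K R]

theorem laurent_coeff_mul (p q : LaurentPolynomial R) (l : ℤ) :
    (p * q).coeff l = ∑ i ∈ p.coeff.support, p.coeff i * q.coeff (l - i) := by
  rw [AddMonoidAlgebra.coeff_mul_apply_left, Finsupp.sum]
  refine Finset.sum_congr rfl fun i _ => ?_
  rw [neg_add_eq_sub]

/-- A coefficient of a product lies in `V` when all its summands do. -/
theorem laurent_coeff_mul_mem (V : Submodule K R) (p q : LaurentPolynomial R) (l : ℤ)
    (h : ∀ i, p.coeff i * q.coeff (l - i) ∈ V) : (p * q).coeff l ∈ V := by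
  rw [laurent_coeff_mul]
  exact Submodule.sum_mem _ fun i _ => h i

/-- A coefficient of a product is congruent modulo `V` to its `i₀`-th summand when all the other
summands lie in `V`. -/
theorem laurent_coeff_mul_sub_mem (V : Submodule K R) (p q : LaurentPolynomial R) (l i₀ : ℤ)
    (h : ∀ i, i ≠ i₀ → p.coeff i * q.coeff (l - i) ∈ V) :
    (p * q).coeff l - p.coeff i₀ * q.coeff (l - i₀) ∈ V := by
  classical
  rw [laurent_coeff_mul]
  by_cases h0 : i₀ ∈ p.coeff.support
  · rw [← Finset.add_sum_erase _ _ h0, add_sub_cancel_left]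
    exact Submodule.sum_mem _ fun i hi => h i (Finset.ne_of_mem_erase hi)
  · rw [Finsupp.notMem_support_iff.1 h0, zero_mul, sub_zero]
    refine Submodule.sum_mem _ fun i hi => h i ?_
    rintro rfl
    exact h0 hi

end Laurent

end QuantumOGr

/-! ### The relations as a Gröbner basis. -/

namespace QuantumOGr

open MvPolynomial StandardMonomials

/-- A relation as a signed sum of coefficients of products of generating functions. -/
theorem relation_eq (a b : AffineWeight) (s : VectorIndex) (l : ℤ) :
    relation a b s l = ∑ j, (quadTerm s j).1 •
      (genFun a b (quadTerm s j).2.1 * genFun a b (quadTerm s j).2.2).coeff l := by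
  rw [relation, pureSpinorQuadric_eq_sum, AddMonoidAlgebra.coeff_sum, Finsupp.finsetSum_apply]
  rfl

theorem gen_of_mem {a b c : AffineWeight} (h : c ∈ Set.Icc a b) :
    gen a b c = monomial (Finsupp.single ⟨c, h⟩ 1) 1 := by
  rw [gen, dif_pos h]
  rfl

theorem gen_of_notMem {a b c : AffineWeight} (h : c ∉ Set.Icc a b) : gen a b c = 0 := by
  rw [gen, dif_neg h]

/-- A relation vanishes when its leading term does. -/
theorem relation_eq_zero {a b : AffineWeight} {s : VectorIndex} {l : ℤ}
    (h : ¬ (leadL s l ∈ Set.Icc a b ∧ leadR s l ∈ Set.Icc a b)) : relation a b s l = 0 := by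
  rw [relation_eq]
  refine Finset.sum_eq_zero fun j _ => ?_
  have hmem : (genFun a b (quadTerm s j).2.1 * genFun a b (quadTerm s j).2.2).coeff l ∈
      (⊥ : Submodule ℂ (PolyRing a b)) := by
    refine laurent_coeff_mul_mem _ _ _ _ fun i => ?_
    rw [coeff_genFun, coeff_genFun, Submodule.mem_bot]
    rcases nested_terms s l i j with ⟨rfl, rfl⟩ | ⟨u, v, huv, h1, h2, h3, h4⟩
    · have e2 : l - l / 2 = l / 2 + l % 2 := by omega
      rw [e2]
      change gen a b (leadL s l) * gen a b (leadR s l) = 0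
      by_cases hL : leadL s l ∈ Set.Icc a b
      · rw [gen_of_notMem (c := leadR s l) (fun hR => h ⟨hL, hR⟩), mul_zero]
      · rw [gen_of_notMem hL, zero_mul]
    · have hz : gen a b u * gen a b v = 0 := by
        by_cases hu : u ∈ Set.Icc a b
        · by_cases hv : v ∈ Set.Icc a b
          · exact absurd ⟨⟨hu.1.trans h1, h3.trans hv.2⟩, ⟨hu.1.trans h2, h4.trans hv.2⟩⟩ h
          · rw [gen_of_notMem hv, mul_zero]
        · rw [gen_of_notMem hu, zero_mul]
      rcases huv with ⟨rfl, rfl⟩ | ⟨rfl, rfl⟩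
      · exact hz
      · rw [mul_comm]; exact hz
  rw [(Submodule.mem_bot ℂ).1 hmem, smul_zero]

/-- A bound for the squares of the heights in an interval. -/
noncomputable def sqBound (a b : AffineWeight) : ℤ := ∑ c ∈ Finset.Icc a b, c.ht * c.ht

/-- The weights of the variables, for which the leading terms are the incomparable products. -/
noncomputable def varWeight (a b : AffineWeight) (c : Set.Icc a b) : ℕ :=
  (sqBound a b - c.1.ht * c.1.ht).toNat

/-- The truncation in `toNat` never takes effect, since `sqBound` includes the square of `c` itself.
The constant cancels when monomials of equal degree are compared. -/
theorem varWeight_eq (a b : AffineWeight) (c : Set.Icc a b) :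
    (varWeight a b c : ℤ) = sqBound a b - c.1.ht * c.1.ht := by
  rw [varWeight, Int.toNat_of_nonneg]
  rw [sub_nonneg]
  exact Finset.single_le_sum (f := fun c : AffineWeight => c.ht * c.ht)
    (fun _ _ => mul_self_nonneg _) (Finset.mem_Icc.2 c.2)

/-- Indices of the relations whose leading term lies in the interval. -/
abbrev RelIndex (a b : AffineWeight) : Type :=
  {q : VectorIndex × ℤ // leadL q.1 q.2 ∈ Set.Icc a b ∧ leadR q.1 q.2 ∈ Set.Icc a b}

/-- The leading exponent of a relation. -/
noncomputable def leadExp (a b : AffineWeight) (q : RelIndex a b) : Set.Icc a b →₀ ℕ :=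
  Finsupp.single ⟨_, q.2.1⟩ 1 + Finsupp.single ⟨_, q.2.2⟩ 1

/-- The nonzero relations. -/
noncomputable def relFamily (a b : AffineWeight) (q : RelIndex a b) : PolyRing a b :=
  relation a b q.1.1 q.1.2

theorem span_relFamily (a b : AffineWeight) :
    Ideal.span (Set.range (relFamily a b)) = relationIdeal a b := by
  apply le_antisymm
  · refine Ideal.span_mono ?_
    rintro _ ⟨q, rfl⟩
    exact ⟨q.1, rfl⟩
  · refine Ideal.span_le.2 ?_
    rintro _ ⟨q, rfl⟩
    by_cases h : leadL q.1 q.2 ∈ Set.Icc a b ∧ leadR q.1 q.2 ∈ Set.Icc a b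
    · exact Ideal.subset_span ⟨⟨q, h⟩, rfl⟩
    · simp only [relation_eq_zero h]
      exact zero_mem _

theorem weight_single_one {a b : AffineWeight} (c : Set.Icc a b) :
    Finsupp.weight (varWeight a b) (Finsupp.single c 1) = varWeight a b c := by
  rw [Finsupp.weight_single, one_smul]

/-- Convexity of the square: with the sum fixed, the more spread-out pair has the larger sum of
squares. Incomparability of `x` and `y` makes the inequalities strict. -/
theorem sq_lt_of_nested {x y u v : AffineWeight} (hxy : ¬ x ≤ y) (hyx : ¬ y ≤ x) (h1 : u ≤ x)
    (h2 : u ≤ y) (hs : u.ht + v.ht = x.ht + y.ht) :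
    x.ht * x.ht + y.ht * y.ht < u.ht * u.ht + v.ht * v.ht := by
  have hx : u.ht < x.ht := AffineWeight.ht_lt_ht (lt_of_le_of_ne h1 (by rintro rfl; exact hxy h2))
  have hy : u.ht < y.ht := AffineWeight.ht_lt_ht (lt_of_le_of_ne h2 (by rintro rfl; exact hyx h1))
  have hv : v.ht = x.ht + y.ht - u.ht := by omega
  rw [hv]
  nlinarith [mul_pos (sub_pos.2 hx) (sub_pos.2 hy)]

theorem relFamily_lead (a b : AffineWeight) (q : RelIndex a b) :
    ∃ c : ℂ, c ≠ 0 ∧ relFamily a b q - c • monomial (leadExp a b q) 1 ∈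
      smallSpan ℂ (varWeight a b) (leadExp a b q) := by
  obtain ⟨⟨s, l⟩, hL, hR⟩ := q
  set V := smallSpan ℂ (varWeight a b) (leadExp a b ⟨(s, l), hL, hR⟩)
  have hsgn : ∀ s j, (quadTerm s j).1 ≠ 0 := by decide +kernel
  refine ⟨((quadTerm s (leadIdx l)).1 : ℂ), by exact_mod_cast hsgn s _, ?_⟩
  have hsmall (j : Fin 4) (i : ℤ) (hji : ¬ (j = leadIdx l ∧ i = l / 2)) :
      (genFun a b (quadTerm s j).2.1).coeff i * (genFun a b (quadTerm s j).2.2).coeff (l - i) ∈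
        V := by
    rw [coeff_genFun, coeff_genFun]
    obtain h | ⟨u, v, huv, h1, h2, h3, h4⟩ := nested_terms s l i j
    · exact absurd h hji
    have hs : u.ht + v.ht = (leadL s l).ht + (leadR s l).ht := by
      rw [← ht_terms s l i j]
      rcases huv with ⟨rfl, rfl⟩ | ⟨rfl, rfl⟩
      · rfl
      · exact add_comm _ _
    have hz : gen a b u * gen a b v ∈ V := by
      by_cases hu : u ∈ Set.Icc a b
      · by_cases hv : v ∈ Set.Icc a b
        · rw [gen_of_mem hu, gen_of_mem hv, monomial_mul, one_mul]
          refine Submodule.subset_span ⟨_, ?_, ?_, rfl⟩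
          · have h5 := sq_lt_of_nested (lead_incomparable s l).1 (lead_incomparable s l).2 h1 h2 hs
            have w1 := varWeight_eq a b ⟨u, hu⟩
            have w2 := varWeight_eq a b ⟨v, hv⟩
            have w3 := varWeight_eq a b ⟨_, hL⟩
            have w4 := varWeight_eq a b ⟨_, hR⟩
            simp only [leadExp, map_add, weight_single_one]
            zify
            rw [w1, w2, w3, w4]
            simp only
            linarith
          · simp [leadExp]
        · rw [gen_of_notMem hv, mul_zero]; exact zero_mem _
      · rw [gen_of_notMem hu, zero_mul]; exact zero_mem _
    rcases huv with ⟨rfl, rfl⟩ | ⟨rfl, rfl⟩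
    · exact hz
    · rw [mul_comm]; exact hz
  have hmono : (monomial (leadExp a b ⟨(s, l), hL, hR⟩) 1 : PolyRing a b) =
      (genFun a b (quadTerm s (leadIdx l)).2.1).coeff (l / 2) *
        (genFun a b (quadTerm s (leadIdx l)).2.2).coeff (l - l / 2) := by
    have e2 : l - l / 2 = l / 2 + l % 2 := by omega
    rw [coeff_genFun, coeff_genFun, e2]
    change _ = gen a b (leadL s l) * gen a b (leadR s l)
    rw [gen_of_mem hL, gen_of_mem hR, monomial_mul, one_mul]
    rfl
  rw [hmono]
  change relation a b s l - _ ∈ V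
  rw [relation_eq, ← Finset.add_sum_erase _ _ (Finset.mem_univ (leadIdx l)), add_sub_right_comm,
    Int.cast_smul_eq_zsmul, ← smul_sub]
  refine add_mem (zsmul_mem ?_ _) (Submodule.sum_mem _ fun j hj => zsmul_mem ?_ _)
  · exact laurent_coeff_mul_sub_mem V _ _ _ _ fun i hi => hsmall _ i fun h => hi h.2
  · exact laurent_coeff_mul_mem V _ _ _ fun i =>
      hsmall j i fun h => (Finset.ne_of_mem_erase hj) h.1

theorem leadExp_eq_iff {a b : AffineWeight} {q : RelIndex a b} {x y : Set.Icc a b}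
    (h : leadExp a b q = Finsupp.single x 1 + Finsupp.single y 1) :
    ∃ p, leadSide q.1.1 q.1.2 p = x.1 ∧ leadSide q.1.1 q.1.2 (!p) = y.1 := by
  classical
  obtain ⟨⟨s, l⟩, hL, hR⟩ := q
  have hx : (⟨leadL s l, hL⟩ : Set.Icc a b) = x ∨ (⟨leadR s l, hR⟩ : Set.Icc a b) = x := by
    by_contra hcon
    rw [not_or] at hcon
    have := DFunLike.congr_fun h x
    simp [leadExp, Finsupp.single_apply, hcon.1, hcon.2] at this
    omega
  rcases hx with rfl | rfl
  · refine ⟨true, rfl, ?_⟩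
    exact congrArg Subtype.val (Finsupp.single_left_injective one_ne_zero (add_left_cancel h))
  · refine ⟨false, rfl, ?_⟩
    rw [leadExp, add_comm] at h
    exact congrArg Subtype.val (Finsupp.single_left_injective one_ne_zero (add_left_cancel h))

theorem leadExp_injective (a b : AffineWeight) : Function.Injective (leadExp a b) := by
  rintro q ⟨⟨s', l'⟩, hL', hR'⟩ h
  obtain ⟨p, h1, h2⟩ := leadExp_eq_iff (h.trans rfl)
  obtain ⟨⟨s, l⟩, hL, hR⟩ := q
  -- Equal leading monomials have their factors matched either in order or swapped. In order, the
  -- levels agree and `t1` applies. Swapped, comparing levels forces both to be even, which `t2`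
  -- excludes.
  have t1 : ∀ (s s' : VectorIndex) (j : Fin 4), (quadTerm s j).2 = (quadTerm s' j).2 → s = s' := by
    decide +kernel
  have t2 : ∀ s s' : VectorIndex, (quadTerm s 0).2.1 = (quadTerm s' 0).2.2 →
      (quadTerm s 0).2.2 ≠ (quadTerm s' 0).2.1 := by
    decide +kernel
  simp only [leadSide, leadL, leadR] at h1 h2
  cases p
  · simp only [Bool.false_eq_true, if_false, Bool.not_false, if_true, AffineWeight.mk.injEq]
      at h1 h2
    have e1 : l % 2 = 0 := by omega
    have e2 : l' % 2 = 0 := by omega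
    simp only [leadIdx, e1, e2, if_true] at h1 h2
    exact absurd h1.1 (t2 _ _ h2.1)
  · simp only [if_true, Bool.not_true, Bool.false_eq_true, if_false, AffineWeight.mk.injEq]
      at h1 h2
    obtain rfl : l = l' := by omega
    obtain rfl := t1 s s' (leadIdx l) (Prod.ext h1.1 h2.1)
    rfl

/-- Takes the coefficient of `z ^ N` in a linear syzygy evaluated at the generating functions. Two
of its summands form the S-pair; each remaining one vanishes, by leaving the interval, or has
smaller weight. -/
theorem relFamily_syz (a b : AffineWeight) (q q' : RelIndex a b) (x y z : Set.Icc a b)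
    (hyz : y ≠ z) (h1 : leadExp a b q = Finsupp.single x 1 + Finsupp.single y 1)
    (h2 : leadExp a b q' = Finsupp.single x 1 + Finsupp.single z 1) :
    monomial (Finsupp.single z 1) 1 * relFamily a b q ∈
      Submodule.span ℂ {monomial (Finsupp.single y 1) 1 * relFamily a b q'} ⊔
        lowerSpan (varWeight a b) (leadExp a b) (relFamily a b) (Finsupp.weight (varWeight a b)
          (Finsupp.single x 1 + Finsupp.single y 1 + Finsupp.single z 1)) := by
  obtain ⟨p, hpx, hpy⟩ := leadExp_eq_iff h1
  obtain ⟨p', hpx', hpz⟩ := leadExp_eq_iff h2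
  obtain ⟨⟨s, l⟩, hL, hR⟩ := q
  obtain ⟨⟨s', l'⟩, hL', hR'⟩ := q'
  simp only at hpx hpy hpx' hpz
  have hne : ¬ (s = s' ∧ l = l') := by
    rintro ⟨rfl, rfl⟩
    have := h1.symm.trans h2
    have := Finsupp.single_left_injective one_ne_zero (add_left_cancel this)
    exact hyz this
  obtain ⟨c, k₁, k₂, hk, hk₁, hk₂, hlev, hall⟩ := exists_syzygy (hpx.trans hpx'.symm) hne
  rw [hpz] at hk₁
  rw [hpy] at hk₂
  rw [hpz, hpy] at hlev
  simp only [hpz, hpy] at hall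
  set V := lowerSpan (varWeight a b) (leadExp a b) (relFamily a b) (Finsupp.weight (varWeight a b)
          (Finsupp.single x 1 + Finsupp.single y 1 + Finsupp.single z 1)) with hV
  set N := z.1.level + l with hN
  have hsq : sqHt z.1 s l = x.1.ht * x.1.ht + y.1.ht * y.1.ht + z.1.ht * z.1.ht := by
    rw [sqHt, ← hpx, ← hpy]
    cases p <;> simp only [leadSide, Bool.not_true, Bool.not_false, if_true, if_false,
      Bool.false_eq_true] <;> ring
  have hterm (k : Fin 5) (i : ℤ) (hki : ¬ (k = k₁ ∧ i = z.1.level) ∧ ¬ (k = k₂ ∧ i = y.1.level)) :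
      (genFun a b (syzTerm c k).2.2).coeff i *
        (pureSpinorQuadric (genFun a b) (syzTerm c k).2.1).coeff (N - i) ∈ V := by
    rw [coeff_genFun]
    change _ * relation a b _ _ ∈ V
    by_cases hb : (⟨(syzTerm c k).2.2, i⟩ : AffineWeight) ∈ Set.Icc a b
    · by_cases hl : leadL (syzTerm c k).2.1 (N - i) ∈ Set.Icc a b ∧
          leadR (syzTerm c k).2.1 (N - i) ∈ Set.Icc a b
      · rw [gen_of_mem hb]
        change _ * relFamily a b ⟨((syzTerm c k).2.1, N - i), hl⟩ ∈ V
        refine mem_lowerSpan ?_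
        have h3 := ((hall k i).resolve_left hki.1).resolve_left hki.2
        rw [hsq, sqHt] at h3
        simp only [leadExp, map_add, weight_single_one]
        zify
        simp only [varWeight_eq]
        linarith
      · rw [relation_eq_zero hl, mul_zero]; exact zero_mem _
    · rw [gen_of_notMem hb, zero_mul]; exact zero_mem _
  set P : Fin 5 → PolyRing a b := fun k => (genFun a b (syzTerm c k).2.2 *
    pureSpinorQuadric (genFun a b) (syzTerm c k).2.1).coeff N with hP
  have hsum : ∑ k, (syzTerm c k).1 • P k = 0 := by
    have := congrArg (fun p : LaurentPolynomial (PolyRing a b) => p.coeff N)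
      (linear_syzygy (genFun a b) c)
    simp only [AddMonoidAlgebra.coeff_sum, Finsupp.finsetSum_apply] at this
    exact this
  have hother (k : Fin 5) (h3 : k ≠ k₁) (h4 : k ≠ k₂) : P k ∈ V :=
    laurent_coeff_mul_mem V _ _ _ fun i => hterm k i ⟨fun h => h3 h.1, fun h => h4 h.1⟩
  have hP₁ : P k₁ - monomial (Finsupp.single z 1) 1 * relFamily a b ⟨(s, l), hL, hR⟩ ∈ V := by
    have := laurent_coeff_mul_sub_mem V (genFun a b (syzTerm c k₁).2.2)
      (pureSpinorQuadric (genFun a b) (syzTerm c k₁).2.1) N z.1.level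
      fun i hi => hterm k₁ i ⟨fun h => hi h.2, fun h => hk h.1⟩
    rw [coeff_genFun] at this
    convert this using 2
    rw [hk₁, ← gen_of_mem z.2, hN, add_sub_cancel_left]
    rfl
  have hP₂ : P k₂ - monomial (Finsupp.single y 1) 1 * relFamily a b ⟨(s', l'), hL', hR'⟩ ∈ V := by
    have := laurent_coeff_mul_sub_mem V (genFun a b (syzTerm c k₂).2.2)
      (pureSpinorQuadric (genFun a b) (syzTerm c k₂).2.1) N y.1.level
      fun i hi => hterm k₂ i ⟨fun h => hk h.1.symm, fun h => hi h.2⟩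
    rw [coeff_genFun] at this
    convert this using 2
    rw [hk₂, ← gen_of_mem y.2, hlev, add_sub_cancel_left]
    rfl
  have hsgn : ∀ c k, (syzTerm c k).1 = 1 ∨ (syzTerm c k).1 = -1 := by decide +kernel
  rw [← Finset.add_sum_erase _ _ (Finset.mem_univ k₁),
    ← Finset.add_sum_erase _ _ (Finset.mem_erase.2 ⟨hk.symm, Finset.mem_univ k₂⟩)] at hsum
  have hrest : ∑ k ∈ (Finset.univ.erase k₁).erase k₂, (syzTerm c k).1 • P k ∈ V := by
    refine Submodule.sum_mem _ fun k hk' => zsmul_mem (hother k ?_ ?_) _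
    · exact Finset.ne_of_mem_erase (Finset.mem_of_mem_erase hk')
    · exact Finset.ne_of_mem_erase hk'
  generalize ∑ k ∈ (Finset.univ.erase k₁).erase k₂, (syzTerm c k).1 • P k = r at hsum hrest
  have hspan := Submodule.mem_span_singleton_self (R := ℂ)
    (monomial (Finsupp.single y 1) 1 * relFamily a b ⟨(s', l'), hL', hR'⟩)
  generalize monomial (Finsupp.single z 1) 1 * relFamily a b ⟨(s, l), hL, hR⟩ = A at *
  generalize monomial (Finsupp.single y 1) 1 * relFamily a b ⟨(s', l'), hL', hR'⟩ = B at *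
  have hfin : ∀ B' ∈ Submodule.span ℂ {B}, ∀ v ∈ V, A = B' + v → A ∈ Submodule.span ℂ {B} ⊔ V := by
    rintro B' hB' v hv rfl
    exact Submodule.add_mem_sup hB' hv
  have hPB : P k₁ - A ∈ V := hP₁
  -- Both coefficients are signs, so the syzygy can be solved for `A`, giving `±B` modulo `V`.
  rcases hsgn c k₁ with e1 | e1 <;> rcases hsgn c k₂ with e2 | e2 <;> rw [e1, e2] at hsum <;>
    simp only [one_smul, neg_smul] at hsum
  · refine hfin (-B) (neg_mem hspan) (-(P k₁ - A) - (P k₂ - B) - r)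
      (sub_mem (sub_mem (neg_mem hP₁) hP₂) hrest) ?_
    linear_combination hsum
  · refine hfin B hspan (-(P k₁ - A) + (P k₂ - B) - r)
      (sub_mem (add_mem (neg_mem hP₁) hP₂) hrest) ?_
    linear_combination hsum
  · refine hfin B hspan (-(P k₁ - A) + (P k₂ - B) + r)
      (add_mem (add_mem (neg_mem hP₁) hP₂) hrest) ?_
    linear_combination -hsum
  · refine hfin (-B) (neg_mem hspan) (-(P k₁ - A) - (P k₂ - B) + r)
      (add_mem (sub_mem (neg_mem hP₁) hP₂) hrest) ?_
    linear_combination -hsum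

theorem relFamily_isLiftable (a b : AffineWeight) :
    IsLiftable (varWeight a b) (leadExp a b) (relFamily a b) := by
  refine IsLiftable.of_quadratic (relFamily_lead a b) (leadExp_injective a b) ?_ ?_
  · rintro ⟨⟨s, l⟩, hL, hR⟩
    refine ⟨⟨_, hL⟩, ⟨_, hR⟩, fun h => ?_, rfl⟩
    exact (lead_incomparable s l).1 (le_of_eq (congrArg Subtype.val h))
  · intro q q' x y z _ _ hyz h1 h2
    exact relFamily_syz a b q q' x y z hyz h1 h2

/-- Standard exponents are those with totally ordered support. -/
theorem isStd_leadExp_iff {a b : AffineWeight} (m : Set.Icc a b →₀ ℕ) :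
    IsStd (leadExp a b) m ↔ IsChain (· ≤ ·) (m.support : Set (Set.Icc a b)) := by
  classical
  constructor
  · intro h x hx y hy hxy
    by_contra hcon
    rw [not_or] at hcon
    have hxm : 1 ≤ m x := Nat.one_le_iff_ne_zero.2 (Finsupp.mem_support_iff.1 hx)
    have hym : 1 ≤ m y := Nat.one_le_iff_ne_zero.2 (Finsupp.mem_support_iff.1 hy)
    have hle : ∀ x y : Set.Icc a b, x ≠ y → 1 ≤ m x → 1 ≤ m y →
        Finsupp.single x 1 + Finsupp.single y 1 ≤ m := by
      intro x y hxy hx hy t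
      rw [Finsupp.add_apply, Finsupp.single_apply, Finsupp.single_apply]
      split_ifs with h1 h2 h2
      · exact absurd (h1.trans h2.symm) hxy
      · subst h1; simpa using hx
      · subst h2; simpa using hy
      · simp
    obtain ⟨s, l, ⟨h1, h2⟩ | ⟨h1, h2⟩⟩ := exists_lead_of_incomparable (a := x.1) (b := y.1)
      hcon.1 hcon.2
    · refine h ⟨(s, l), by simp only [h1, h2]; exact ⟨x.2, y.2⟩⟩ ?_
      simp only [leadExp, h1, h2]
      exact hle x y hxy hxm hym
    · refine h ⟨(s, l), by simp only [h1, h2]; exact ⟨y.2, x.2⟩⟩ ?_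
      simp only [leadExp, h1, h2]
      exact hle y x hxy.symm hym hxm
  · rintro h ⟨⟨s, l⟩, hL, hR⟩ hle
    have hinc := lead_incomparable s l
    have hmem : ∀ x, leadExp a b ⟨(s, l), hL, hR⟩ x ≠ 0 → x ∈ (m.support : Set (Set.Icc a b)) := by
      intro x hx
      have := hle x
      exact Finsupp.mem_support_iff.2 (by omega)
    have h1 := hmem ⟨_, hL⟩ (by simp [leadExp])
    have h2 := hmem ⟨_, hR⟩ (by simp [leadExp])
    rcases h.total h1 h2 with h3 | h3
    · exact hinc.1 h3
    · exact hinc.2 h3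

/-! ### Multichains and their generating functions. -/

/-- Multichains of length `n` in a set of affine weights, encoded by multiplicities. -/
def multichains (S : Set AffineWeight) (n : ℕ) : Set (AffineWeight →₀ ℕ) :=
  {m | (m.support : Set AffineWeight) ⊆ S ∧
    IsChain (· ≤ ·) (m.support : Set AffineWeight) ∧ m.degree = n}

/-- The dimension of a graded piece is the number of multichains in the interval. -/
theorem finrank_gradedPiece (a b : AffineWeight) (n : ℕ) :
    Module.finrank ℂ (gradedPiece a b n) = (multichains (Set.Icc a b) n).ncard := by
  have h := (relFamily_isLiftable a b).finrank_map_homogeneousSubmodule n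
  rw [span_relFamily] at h
  rw [gradedPiece, h, ← Nat.card_coe_set_eq]
  refine Nat.card_congr ?_
  -- Exponents are extended by zero to the whole poset, so that multichains in different intervals
  -- can be compared.
  refine Equiv.ofBijective (fun m => ⟨m.1.embDomain (Function.Embedding.subtype _), ?_, ?_, ?_⟩)
    ⟨?_, ?_⟩
  · rw [Finsupp.support_embDomain, Finset.coe_map]
    rintro _ ⟨x, -, rfl⟩
    exact x.2
  · rw [Finsupp.support_embDomain, Finset.coe_map]
    have := (isStd_leadExp_iff m.1).1 m.2.1
    rintro _ ⟨x, hx, rfl⟩ _ ⟨y, hy, rfl⟩ hxy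
    exact this hx hy fun h => hxy (congrArg _ h)
  · rw [Finsupp.embDomain_eq_mapDomain, Finsupp.degree_mapDomain]
    exact m.2.2
  · intro m m' hmm
    exact Subtype.ext (Finsupp.embDomain_injective _ (congrArg Subtype.val hmm))
  · rintro ⟨m, h1, h2, h3⟩
    have hm := Finsupp.embDomain_comapDomain (f := Function.Embedding.subtype (· ∈ Set.Icc a b))
      (g := m) (fun x hx => ⟨⟨x, h1 hx⟩, rfl⟩)
    generalize m.comapDomain _ _ = m₀ at hm
    subst hm
    refine ⟨⟨m₀, ?_, ?_⟩, rfl⟩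
    · rw [isStd_leadExp_iff]
      rw [Finsupp.support_embDomain, Finset.coe_map] at h2
      intro x hx y hy hxy
      exact h2 ⟨x, hx, rfl⟩ ⟨y, hy, rfl⟩ fun h => hxy (Subtype.ext h)
    · rwa [Finsupp.embDomain_eq_mapDomain, Finsupp.degree_mapDomain] at h3

end QuantumOGr

namespace QuantumOGr

theorem finite_multichains {S : Set AffineWeight} (hS : S.Finite) (n : ℕ) :
    (multichains S n).Finite := by
  classical
  have : Finite S := hS
  refine ((Finsupp.finite_of_degree_eq (σ := S) n).image
    (Finsupp.embDomain (Function.Embedding.subtype _))).subset ?_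
  rintro m ⟨h1, -, h3⟩
  have hm := Finsupp.embDomain_comapDomain (f := Function.Embedding.subtype (· ∈ S))
      (g := m) (fun x hx => ⟨⟨x, h1 hx⟩, rfl⟩)
  refine ⟨_, ?_, hm⟩
  rw [← hm, Finsupp.embDomain_eq_mapDomain, Finsupp.degree_mapDomain] at h3
  exact h3

theorem multichains_inter (S T : Set AffineWeight) (n : ℕ) :
    multichains S n ∩ multichains T n = multichains (S ∩ T) n := by
  ext m
  simp only [multichains, Set.mem_inter_iff, Set.mem_ofPred_eq, Set.subset_inter_iff]
  tauto

/-- The generating function of multichains in a set. -/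
noncomputable def multichainSeries (S : Set AffineWeight) : PowerSeries ℤ :=
  PowerSeries.mk fun n => ((multichains S n).ncard : ℤ)

theorem poincareSeries_eq (a b : AffineWeight) :
    poincareSeries a b = multichainSeries (Set.Icc a b) := by
  simp only [poincareSeries, multichainSeries, finrank_gradedPiece]

theorem multichains_zero (S : Set AffineWeight) : multichains S 0 = {0} := by
  ext m
  simp only [multichains, Set.mem_ofPred_eq, Set.mem_singleton_iff]
  constructor
  · rintro ⟨-, -, h⟩
    exact (Finsupp.degree_eq_zero_iff m).1 h
  · rintro rfl
    simp [IsChain]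

/-- Multichains in a set with a greatest element either avoid it or contain it. -/
theorem ncard_multichains_succ {S : Set AffineWeight} (hS : S.Finite) {x : AffineWeight}
    (hx : IsGreatest S x) (n : ℕ) :
    (multichains S (n + 1)).ncard =
      (multichains (S \ {x}) (n + 1)).ncard + (multichains S n).ncard := by
  classical
  have h1 : multichains S (n + 1) = multichains (S \ {x}) (n + 1) ∪
      (fun m => m + Finsupp.single x 1) '' multichains S n := by
    ext m
    constructor
    · rintro ⟨hs, hc, hd⟩
      by_cases hm : m x = 0
      · left
        refine ⟨fun y hy => ⟨hs hy, ?_⟩, hc, hd⟩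
        rintro rfl
        exact (Finsupp.mem_support_iff.1 hy) hm
      · right
        have hle : Finsupp.single x 1 ≤ m :=
          Finsupp.single_le_iff.2 (Nat.one_le_iff_ne_zero.2 hm)
        have hsub : (((m - Finsupp.single x 1).support : Finset AffineWeight) :
            Set AffineWeight) ⊆ m.support := Finset.coe_subset.2 Finsupp.support_tsub
        refine ⟨m - Finsupp.single x 1, ⟨hsub.trans hs, hc.mono hsub, ?_⟩,
          tsub_add_cancel_of_le hle⟩
        have := congrArg Finsupp.degree (tsub_add_cancel_of_le hle)
        rw [map_add, Finsupp.degree_single, hd] at this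
        exact Nat.succ_injective this
    · rintro (⟨hs, hc, hd⟩ | ⟨m, ⟨hs, hc, hd⟩, rfl⟩)
      · exact ⟨hs.trans Set.sdiff_subset, hc, hd⟩
      · have hsub : (((m + Finsupp.single x 1).support : Finset AffineWeight) :
            Set AffineWeight) ⊆ insert x (m.support : Set AffineWeight) := by
          intro y hy
          by_cases hyx : y = x
          · exact Or.inl hyx
          · right
            simpa [Finsupp.single_apply, Ne.symm hyx] using hy
        refine ⟨hsub.trans (Set.insert_subset hx.1 hs), ?_, ?_⟩
        · refine IsChain.mono hsub (hc.insert fun y hy _ => Or.inr (hx.2 (hs hy)))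
        · rw [map_add, Finsupp.degree_single, hd]
  have hdisj : Disjoint (multichains (S \ {x}) (n + 1))
      ((fun m => m + Finsupp.single x 1) '' multichains S n) := by
    rw [Set.disjoint_left]
    rintro _ ⟨hs, -, -⟩ ⟨m, -, rfl⟩
    have : x ∈ ((m + Finsupp.single x 1).support : Set AffineWeight) := by simp
    exact (hs this).2 rfl
  rw [h1, Set.ncard_union_eq hdisj (finite_multichains (hS.subset Set.sdiff_subset) _)
    ((finite_multichains hS n).image _), Set.ncard_image_of_injective _ (add_left_injective _)]

theorem one_sub_X_mul_multichainSeries {S : Set AffineWeight} (hS : S.Finite) {x : AffineWeight}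
    (hx : IsGreatest S x) :
    (1 - PowerSeries.X) * multichainSeries S = multichainSeries (S \ {x}) := by
  ext n
  rw [sub_mul, one_mul, map_sub]
  cases n with
  | zero => simp [multichainSeries, multichains_zero]
  | succ n =>
    rw [PowerSeries.coeff_succ_X_mul]
    simp only [multichainSeries, PowerSeries.coeff_mk, ncard_multichains_succ hS hx n]
    push_cast
    ring

/-- Inclusion-exclusion for multichains when every one of them lies in one of two sets. -/
theorem multichainSeries_union {S T : Set AffineWeight} (hS : S.Finite) (hT : T.Finite)
    (h : ∀ n, multichains (S ∪ T) n ⊆ multichains S n ∪ multichains T n) :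
    multichainSeries (S ∪ T) =
      multichainSeries S + multichainSeries T - multichainSeries (S ∩ T) := by
  ext n
  have h1 : multichains (S ∪ T) n = multichains S n ∪ multichains T n := by
    refine (h n).antisymm (Set.union_subset ?_ ?_)
    · exact fun m hm => ⟨hm.1.trans Set.subset_union_left, hm.2⟩
    · exact fun m hm => ⟨hm.1.trans Set.subset_union_right, hm.2⟩
  have h2 := Set.ncard_union_add_ncard_inter (multichains S n) (multichains T n)
    (finite_multichains hS n) (finite_multichains hT n)
  rw [multichains_inter, ← h1] at h2
  rw [map_sub, map_add]
  simp only [multichainSeries, PowerSeries.coeff_mk]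
  omega

/-- A nonempty finite chain has a largest element. Whichever interval contains it contains the whole
chain, since both intervals start at `o`. -/
theorem multichains_subset_of_lower {o y z : AffineWeight} (n : ℕ) :
    multichains (Set.Icc o y ∪ Set.Icc o z) n ⊆
      multichains (Set.Icc o y) n ∪ multichains (Set.Icc o z) n := by
  rintro m ⟨hs, hc, hd⟩
  by_cases hne : m.support.Nonempty
  · obtain ⟨t, ht, hmax⟩ := m.support.exists_max_image AffineWeight.ht hne
    have htop : ∀ u ∈ m.support, u ≤ t := by
      intro u hu
      rcases hc.total hu ht with h | h
      · exact h
      · rcases h.lt_or_eq with h' | h'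
        · exact absurd (hmax u hu) (not_le.2 (AffineWeight.ht_lt_ht h'))
        · exact h'.ge
    have ho : ∀ u ∈ m.support, o ≤ u := fun u hu => (hs hu).elim (fun h => h.1) (fun h => h.1)
    rcases hs ht with h | h
    · exact Or.inl ⟨fun u hu => ⟨ho u hu, (htop u hu).trans h.2⟩, hc, hd⟩
    · exact Or.inr ⟨fun u hu => ⟨ho u hu, (htop u hu).trans h.2⟩, hc, hd⟩
  · rw [Finset.not_nonempty_iff_eq_empty] at hne
    exact Or.inl ⟨by simp [hne], hc, hd⟩

/-- Recursion at an element with one lower cover. -/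
theorem series_of_one_cover {o x y : AffineWeight} (hox : o ≤ x)
    (h : ∀ c, o ≤ c → (c < x ↔ c ≤ y)) :
    (1 - PowerSeries.X) * multichainSeries (Set.Icc o x) = multichainSeries (Set.Icc o y) := by
  rw [one_sub_X_mul_multichainSeries (finite_Icc o x) (x := x) ⟨⟨hox, le_rfl⟩, fun _ h => h.2⟩]
  congr 1
  ext c
  simp only [Set.mem_sdiff, Set.mem_Icc, Set.mem_singleton_iff, and_assoc]
  refine and_congr_right fun hc => ?_
  rw [← h c hc, lt_iff_le_and_ne]

/-- Recursion at an element with two lower covers. -/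
theorem series_of_two_covers {o x y z t : AffineWeight} (hox : o ≤ x)
    (h : ∀ c, o ≤ c → (c < x ↔ c ≤ y ∨ c ≤ z)) (ht : ∀ c, o ≤ c → (c ≤ y ∧ c ≤ z ↔ c ≤ t)) :
    (1 - PowerSeries.X) * multichainSeries (Set.Icc o x) =
      multichainSeries (Set.Icc o y) + multichainSeries (Set.Icc o z) -
        multichainSeries (Set.Icc o t) := by
  rw [one_sub_X_mul_multichainSeries (finite_Icc o x) (x := x) ⟨⟨hox, le_rfl⟩, fun _ h => h.2⟩]
  have h1 : Set.Icc o x \ {x} = Set.Icc o y ∪ Set.Icc o z := by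
    ext c
    simp only [Set.mem_sdiff, Set.mem_Icc, Set.mem_singleton_iff, and_assoc, Set.mem_union]
    rw [← and_or_left]
    refine and_congr_right fun hc => ?_
    rw [← h c hc, lt_iff_le_and_ne]
  have h2 : Set.Icc o y ∩ Set.Icc o z = Set.Icc o t := by
    ext c
    simp only [Set.mem_inter_iff, Set.mem_Icc]
    constructor
    · rintro ⟨⟨h3, h4⟩, -, h5⟩
      exact ⟨h3, (ht c h3).1 ⟨h4, h5⟩⟩
    · rintro ⟨h3, h4⟩
      exact ⟨⟨h3, ((ht c h3).2 h4).1⟩, h3, ((ht c h3).2 h4).2⟩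
  rw [h1, multichainSeries_union (finite_Icc o y) (finite_Icc o z) multichains_subset_of_lower, h2]

end QuantumOGr

/-! ### The recursion along the strip and the Delannoy polynomials. -/

namespace QuantumOGr

/-- The lower covers of the elements `deltaHat r`. -/
def betaHat : ℕ → AffineWeight
  | 0 => ⟨.w14, 0⟩
  | 1 => ⟨.w34, 0⟩
  | 2 => ⟨.w45, 0⟩
  | 3 => ⟨.p2, 0⟩
  | r + 4 => ⟨(betaHat r).weight, (betaHat r).level + 1⟩

/-- The elements incomparable with `betaHat r` at the same height. -/
def gammaHat : ℕ → AffineWeight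
  | 0 => ⟨.w23, 0⟩
  | 1 => ⟨.w25, 0⟩
  | 2 => ⟨.p4, 0⟩
  | 3 => ⟨.w12, 1⟩
  | r + 4 => ⟨(gammaHat r).weight, (gammaHat r).level + 1⟩

/-- The joins of `betaHat r` and `gammaHat r`. -/
def epsilonHat : ℕ → AffineWeight
  | 0 => ⟨.w24, 0⟩
  | 1 => ⟨.w35, 0⟩
  | 2 => ⟨.p3, 0⟩
  | 3 => ⟨.w13, 1⟩
  | r + 4 => ⟨(epsilonHat r).weight, (epsilonHat r).level + 1⟩

theorem coord_deltaHat : ∀ r : ℕ,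
    (deltaHat r).fst = r + 4 - 2 * ((r : ℤ) % 2) ∧ (deltaHat r).snd = r + 2 * ((r : ℤ) % 2)
  | 0 | 1 | 2 | 3 => by decide
  | r + 4 => by
    have ih := coord_deltaHat r
    simp only [AffineWeight.fst, AffineWeight.snd] at ih
    simp only [deltaHat, AffineWeight.fst, AffineWeight.snd]
    push_cast
    omega

theorem coord_betaHat : ∀ r : ℕ,
    (betaHat r).fst = r + 3 - (r : ℤ) % 2 ∧ (betaHat r).snd = r + (r : ℤ) % 2
  | 0 | 1 | 2 | 3 => by decide
  | r + 4 => by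
    have ih := coord_betaHat r
    simp only [AffineWeight.fst, AffineWeight.snd] at ih
    simp only [betaHat, AffineWeight.fst, AffineWeight.snd]
    push_cast
    omega

theorem coord_gammaHat : ∀ r : ℕ,
    (gammaHat r).fst = r + 2 + (r : ℤ) % 2 ∧ (gammaHat r).snd = r + 1 - (r : ℤ) % 2
  | 0 | 1 | 2 | 3 => by decide
  | r + 4 => by
    have ih := coord_gammaHat r
    simp only [AffineWeight.fst, AffineWeight.snd] at ih
    simp only [gammaHat, AffineWeight.fst, AffineWeight.snd]
    push_cast
    omega

theorem coord_epsilonHat : ∀ r : ℕ,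
    (epsilonHat r).fst = r + 3 ∧ (epsilonHat r).snd = r + 1
  | 0 | 1 | 2 | 3 => by decide
  | r + 4 => by
    have ih := coord_epsilonHat r
    simp only [AffineWeight.fst, AffineWeight.snd] at ih
    simp only [epsilonHat, AffineWeight.fst, AffineWeight.snd]
    push_cast
    omega

/-- The generating function of multichains from `(0)^0` to `x`. -/
noncomputable def lowerSeries (x : AffineWeight) : PowerSeries ℤ :=
  multichainSeries (Set.Icc ⟨.o, 0⟩ x)

theorem lowerSeries_one_cover {x y : AffineWeight} (hox : (⟨.o, 0⟩ : AffineWeight) ≤ x)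
    (h : ∀ c : AffineWeight, 2 ≤ c.fst → -2 ≤ c.snd → (c < x ↔ c ≤ y)) :
    (1 - PowerSeries.X) * lowerSeries x = lowerSeries y :=
  series_of_one_cover hox fun c hc => by
    rw [AffineWeight.le_iff] at hc
    exact h c hc.1 hc.2

/-- `deltaHat r` runs along the two boundary lines of the strip alternately. The strip leaves it a
single lower cover. -/
theorem delta_cover (r : ℕ) :
    (1 - PowerSeries.X) * lowerSeries (deltaHat r) = lowerSeries (betaHat r) := by
  have h1 := coord_deltaHat r
  have h2 := coord_betaHat r
  refine lowerSeries_one_cover ?_ fun c _ _ => ?_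
  · rw [AffineWeight.le_iff, h1.1, h1.2]
    simp only [AffineWeight.fst, AffineWeight.snd, Weight.fst, Weight.snd]
    omega
  · have := c.strip
    rw [AffineWeight.le_iff, AffineWeight.lt_iff]
    omega

/-- The other candidate for a lower cover is one of the removed boundary points. -/
theorem beta_cover (r : ℕ) :
    (1 - PowerSeries.X) * lowerSeries (betaHat (r + 1)) = lowerSeries (epsilonHat r) := by
  have h1 := coord_betaHat (r + 1)
  have h2 := coord_epsilonHat r
  push_cast at h1
  refine lowerSeries_one_cover ?_ fun c _ _ => ?_
  · rw [AffineWeight.le_iff, h1.1, h1.2]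
    simp only [AffineWeight.fst, AffineWeight.snd, Weight.fst, Weight.snd]
    omega
  · have := c.strip
    rw [AffineWeight.le_iff, AffineWeight.lt_iff]
    omega

theorem gamma_cover (r : ℕ) :
    (1 - PowerSeries.X) * lowerSeries (gammaHat (r + 1)) =
      lowerSeries (epsilonHat r) + lowerSeries (deltaHat r) - lowerSeries (betaHat r) := by
  have h1 := coord_gammaHat (r + 1)
  have h2 := coord_epsilonHat r
  have h3 := coord_deltaHat r
  have h4 := coord_betaHat r
  push_cast at h1
  refine series_of_two_covers ?_ (fun c _ => ?_) (fun c _ => ?_)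
  · rw [AffineWeight.le_iff, h1.1, h1.2]
    simp only [AffineWeight.fst, AffineWeight.snd, Weight.fst, Weight.snd]
    omega
  · have := c.strip
    rw [AffineWeight.le_iff, AffineWeight.le_iff, AffineWeight.lt_iff]
    omega
  · have := c.strip
    rw [AffineWeight.le_iff, AffineWeight.le_iff, AffineWeight.le_iff]
    omega

theorem epsilon_cover (r : ℕ) :
    (1 - PowerSeries.X) * lowerSeries (epsilonHat (r + 1)) =
      lowerSeries (betaHat (r + 1)) + lowerSeries (gammaHat (r + 1)) -
        lowerSeries (epsilonHat r) := by
  have h1 := coord_epsilonHat (r + 1)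
  have h2 := coord_betaHat (r + 1)
  have h3 := coord_gammaHat (r + 1)
  have h4 := coord_epsilonHat r
  push_cast at h1 h2 h3
  refine series_of_two_covers ?_ (fun c _ => ?_) (fun c _ => ?_)
  · rw [AffineWeight.le_iff, h1.1, h1.2]
    simp only [AffineWeight.fst, AffineWeight.snd, Weight.fst, Weight.snd]
    omega
  · have := c.strip
    rw [AffineWeight.le_iff, AffineWeight.le_iff, AffineWeight.lt_iff]
    omega
  · have := c.strip
    rw [AffineWeight.le_iff, AffineWeight.le_iff, AffineWeight.le_iff]
    omega

theorem lowerSeries_o : (1 - PowerSeries.X) * lowerSeries ⟨.o, 0⟩ = 1 := by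
  rw [lowerSeries, one_sub_X_mul_multichainSeries (finite_Icc _ _) (x := ⟨.o, 0⟩)
    ⟨⟨le_rfl, le_rfl⟩, fun _ h => h.2⟩, Set.Icc_self, Set.sdiff_self]
  ext n
  rw [multichainSeries, PowerSeries.coeff_mk, PowerSeries.coeff_one]
  cases n with
  | zero => simp [multichains_zero]
  | succ n =>
    have : multichains ∅ (n + 1) = ∅ := by
      rw [Set.eq_empty_iff_forall_notMem]
      rintro m ⟨h1, -, h2⟩
      have : m = 0 := by simpa using h1
      simp [this] at h2
    simp [this]

theorem lowerSeries_cover_of_weights {α β : Weight}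
    (h1 : 2 ≤ α.fst ∧ -2 ≤ α.snd) (h : ∀ c : AffineWeight, 2 ≤ c.fst → -2 ≤ c.snd →
      (c < ⟨α, 0⟩ ↔ c ≤ ⟨β, 0⟩)) :
    (1 - PowerSeries.X) * lowerSeries ⟨α, 0⟩ = lowerSeries ⟨β, 0⟩ := by
  refine lowerSeries_one_cover ?_ h
  rw [AffineWeight.le_iff]
  simpa [AffineWeight.fst, AffineWeight.snd, Weight.fst, Weight.snd] using h1

/-- The general recursions begin only above these elements. Some of them have further covers in the
full poset, at level `-1`, which the lower bound `(0)^0` excludes. -/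
theorem initial_covers :
    (1 - PowerSeries.X) * lowerSeries ⟨.w12, 0⟩ = lowerSeries ⟨.o, 0⟩ ∧
    (1 - PowerSeries.X) * lowerSeries ⟨.w13, 0⟩ = lowerSeries ⟨.w12, 0⟩ ∧
    (1 - PowerSeries.X) * lowerSeries ⟨.w14, 0⟩ = lowerSeries ⟨.w13, 0⟩ ∧
    (1 - PowerSeries.X) * lowerSeries ⟨.w23, 0⟩ = lowerSeries ⟨.w13, 0⟩ := by
  refine ⟨?_, ?_, ?_, ?_⟩ <;>
  · refine lowerSeries_cover_of_weights (by decide) fun c h1 h2 => ?_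
    have := c.strip
    rw [AffineWeight.le_iff, AffineWeight.lt_iff]
    simp only [AffineWeight.fst, AffineWeight.snd, Weight.fst, Weight.snd] at *
    omega

theorem epsilon_zero :
    (1 - PowerSeries.X) * lowerSeries (epsilonHat 0) =
      lowerSeries (betaHat 0) + lowerSeries (gammaHat 0) - lowerSeries ⟨.w13, 0⟩ := by
  refine series_of_two_covers ?_ (fun c _ => ?_) (fun c _ => ?_)
  · rw [AffineWeight.le_iff]
    decide
  · have := c.strip
    rw [AffineWeight.le_iff, AffineWeight.le_iff, AffineWeight.lt_iff]
    simp only [epsilonHat, betaHat, gammaHat, AffineWeight.fst, AffineWeight.snd, Weight.fst,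
      Weight.snd] at *
    omega
  · have := c.strip
    rw [AffineWeight.le_iff, AffineWeight.le_iff, AffineWeight.le_iff]
    simp only [betaHat, gammaHat, AffineWeight.fst, AffineWeight.snd, Weight.fst,
      Weight.snd] at *
    omega

/-- Elimination of the other three series. Writing `D`, `E` for the series of `deltaHat`,
`epsilonHat` and `t` for the variable, the covers give `E r = (1 - t) ^ 2 * D (r + 1)` and `(1 - t)
^ 2 * E (r + 1) = (1 + t) * E r + t * D r`. -/
theorem lowerSeries_deltaHat_add_two (r : ℕ) :
    (1 - PowerSeries.X) ^ 4 * lowerSeries (deltaHat (r + 2)) =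
      (1 + PowerSeries.X) * (1 - PowerSeries.X) ^ 2 * lowerSeries (deltaHat (r + 1)) +
        PowerSeries.X * lowerSeries (deltaHat r) := by
  have a0 := delta_cover r
  have a1 := delta_cover (r + 1)
  have a2 := delta_cover (r + 2)
  have b1 := beta_cover r
  have b2 := beta_cover (r + 1)
  have c1 := gamma_cover r
  have d1 := epsilon_cover r
  have e1 : lowerSeries (epsilonHat r) =
      (1 - PowerSeries.X) ^ 2 * lowerSeries (deltaHat (r + 1)) := by
    rw [← b1, ← a1]; ring
  have e2 : (1 - PowerSeries.X) ^ 4 * lowerSeries (deltaHat (r + 2)) =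
      (1 - PowerSeries.X) ^ 2 * lowerSeries (epsilonHat (r + 1)) := by
    rw [← b2, ← a2]; ring
  rw [e2, sq, mul_assoc, d1, mul_sub, mul_add, b1, c1, ← a0, e1]
  ring

/-- Below `deltaHat 0` lies a chain of five elements. Below `deltaHat 1` the only branching is the
square formed by `w13`, `w14`, `w23`, `w24`, which produces the numerator `2 - (1 - t) = 1 + t`. -/
theorem delannoy_initial :
    lowerSeries (deltaHat 0) * (1 - PowerSeries.X) ^ 5 = 1 ∧
    lowerSeries (deltaHat 1) * (1 - PowerSeries.X) ^ 7 = 1 + PowerSeries.X := by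
  obtain ⟨h1, h2, h3, h4⟩ := initial_covers
  have h0 := lowerSeries_o
  have a0 : (1 - PowerSeries.X) * lowerSeries (deltaHat 0) = lowerSeries ⟨.w14, 0⟩ := delta_cover 0
  have a1 := delta_cover 1
  have b1 : (1 - PowerSeries.X) * lowerSeries (betaHat 1) = lowerSeries (epsilonHat 0) :=
    beta_cover 0
  have d0 : (1 - PowerSeries.X) * lowerSeries (epsilonHat 0) =
    lowerSeries ⟨.w14, 0⟩ + lowerSeries ⟨.w23, 0⟩ - lowerSeries ⟨.w13, 0⟩ := epsilon_zero
  constructor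
  · rw [← h1, ← h2, ← h3, ← a0] at h0
    linear_combination h0
  · have e : lowerSeries (deltaHat 1) * (1 - PowerSeries.X) ^ 7 = (1 - PowerSeries.X) ^ 4 *
      ((1 - PowerSeries.X) * ((1 - PowerSeries.X) *
        ((1 - PowerSeries.X) * lowerSeries (deltaHat 1)))) := by ring
    have h5 : (1 - PowerSeries.X) ^ 3 * lowerSeries ⟨.w13, 0⟩ = 1 := by
      rw [← h1, ← h2] at h0
      linear_combination h0
    have e2 : (1 - PowerSeries.X) ^ 4 * (lowerSeries ⟨.w14, 0⟩ + lowerSeries ⟨.w23, 0⟩ -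
        lowerSeries ⟨.w13, 0⟩) = (1 - PowerSeries.X) ^ 3 * ((1 - PowerSeries.X) *
        lowerSeries ⟨.w14, 0⟩ + (1 - PowerSeries.X) * lowerSeries ⟨.w23, 0⟩ -
        (1 - PowerSeries.X) * lowerSeries ⟨.w13, 0⟩) := by ring
    rw [e, a1, b1, d0, e2, h3, h4]
    linear_combination (1 + PowerSeries.X) * h5

theorem lowerSeries_deltaHat : ∀ r : ℕ,
    lowerSeries (deltaHat r) * (1 - PowerSeries.X) ^ (5 + 2 * r) =
      (delannoyPoly r : PowerSeries ℤ)
  | 0 => by simpa [delannoyPoly] using delannoy_initial.1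
  | 1 => by simpa [delannoyPoly] using delannoy_initial.2
  | r + 2 => by
    have ih0 := lowerSeries_deltaHat r
    have ih1 := lowerSeries_deltaHat (r + 1)
    have h := lowerSeries_deltaHat_add_two r
    rw [delannoyPoly]
    push_cast
    rw [← ih0, ← ih1]
    -- The exponents match because `5 + 2 (r + 2) = 4 + (5 + 2 r)` and `5 + 2 (r + 1) = 2 + (5 + 2
    -- r)`.
    linear_combination (1 - PowerSeries.X) ^ (5 + 2 * r) * h

end QuantumOGr

theorem mainTheorem9 (r : ℕ) :
    QuantumOGr.poincareSeries ⟨QuantumOGr.Weight.o, 0⟩ (QuantumOGr.deltaHat r)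
        * (1 - PowerSeries.X) ^ (5 + 2 * r) =
      (QuantumOGr.delannoyPoly r : PowerSeries ℤ) := by
  rw [QuantumOGr.poincareSeries_eq]
  exact QuantumOGr.lowerSeries_deltaHat r
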